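/- Let $\Theta=(\theta_m)_{m\ge 1}$ be a sequence of non-negative real numbers. For $\sigma$ in the symmetric group $\mathfrak{S}_n$ let $C_m=C_m(\sigma)$ be the number of cycles of length $m$ in the cycle decomposition of $\sigma$ (fixed points are cycles of length $1$; $C_m=0$ for $m>n$). Put $$h_n=\frac1{n!}\sum_{\sigma\in\mathfrak{S}_n}\prod_{m=1}^n\theta_m^{C_m(\sigma)}\qquad(0^0=1),$$ and, whenever $h_n>0$, let $\mathbb{P}_\Theta$ be the probability measure on $\mathfrak{S}_n$ given by $$\mathbb{P}_\Theta[\sigma]=\frac1{h_n\,n!}\prod_{m=1}^n\theta_m^{C_m(\sigma)}.$$ Assume that the generating series $g_\Theta(t)=\sum_{m\ge1}\frac{\theta_m}{m}t^m$ satisfies the following conditions: - it converges to a holomorphic function for $|t|<1$; - it extends continuously to the punctured closed disc $\{|t|\le1,\ t\ne1\}$ (the extension is again denoted by $g_\Theta$); - there are an integer $k\ge1$ and a polynomial $P(r)=\frac{r^{k+1}}{k+1}+\sum_{j=0}^k c_jr^j$ with real coefficients $c_j$ such that, with the principal branch of the logarithm, $$g_\Theta(e^{-w})=P(-\log w)+O(w)\qquad\text{as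 } w\to0,\ \Re(w)\ge0,\ w\neq 0.$$ Then $h_n>0$ for all sufficiently large $n$, and for each fixed $b\in\mathbb{N}$, if $\mathfrak{S}_n$ is endowed with $\mathbb{P}_\Theta$, we have as $n\to\infty$ (through the $n$ with $h_n>0$) $$(C_1,C_2,\dots,C_b)\ \stackrel{d}{\longrightarrow}\ (Y_1,\dots,Y_b),$$ where $Y_1,\dots,Y_b$ are independent Poisson random variables with $\mathbb{E}[Y_m]=\theta_m/m$ (a Poisson variable of mean $0$ is identically $0$ almost surely). -/

import Mathlib

open Filter MeasureTheory ProbabilityTheory Asymptotics Topology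
open scoped NNReal ENNReal Nat

namespace LogCycles

/-- The symmetric group on `n` letters carries the σ-algebra of all its subsets. -/
instance (n : ℕ) : MeasurableSpace (Equiv.Perm (Fin n)) := ⊤

instance (n : ℕ) : DiscreteMeasurableSpace (Equiv.Perm (Fin n)) := ⟨fun _ => trivial⟩

/-- The cycle count `C_m(σ)`: the number of cycles of length `m` in the cycle decomposition of `σ`.
(The parts of `σ.partition` are the lengths of all cycles of `σ`, fixed points included.) -/
def cycleCount {n : ℕ} (m : ℕ) (σ : Equiv.Perm (Fin n)) : ℕ :=
  σ.partition.parts.count m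

/-- The weight `∏_{m=1}^n θ_m ^ C_m(σ)`, with the convention `0 ^ 0 = 1`.
Only the values `θ m` with `m ≥ 1` matter. -/
noncomputable def weight (θ : ℕ → ℝ≥0) {n : ℕ} (σ : Equiv.Perm (Fin n)) : ℝ≥0 :=
  ∏ m ∈ Finset.Icc 1 n, θ m ^ cycleCount m σ

/-- The normalization constant `h_n = (1 / n!) ∑_σ ∏_{m=1}^n θ_m ^ C_m(σ)`. -/
noncomputable def normConst (θ : ℕ → ℝ≥0) (n : ℕ) : ℝ≥0 :=
  (∑ σ : Equiv.Perm (Fin n), weight θ σ) / (n ! : ℝ≥0)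

/-- The weighted measure on the symmetric group, giving each `σ` the mass
`weight θ σ / (h_n n!)`. It is a probability measure as soon as `h_n ≠ 0`. -/
noncomputable def weightedMeasure (θ : ℕ → ℝ≥0) (n : ℕ) : Measure (Equiv.Perm (Fin n)) :=
  ∑ σ : Equiv.Perm (Fin n),
    ((weight θ σ / (normConst θ n * (n ! : ℝ≥0)) : ℝ≥0) : ℝ≥0∞) • Measure.dirac σ

instance (θ : ℕ → ℝ≥0) (n : {n : ℕ // 0 < normConst θ n}) :
    IsProbabilityMeasure (weightedMeasure θ n) where
  measure_univ := by
    obtain ⟨n, hn⟩ := n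
    have hf : (n ! : ℝ≥0) ≠ 0 := by exact_mod_cast n.factorial_ne_zero
    have hs : (∑ σ : Equiv.Perm (Fin n), weight θ σ) = normConst θ n * (n ! : ℝ≥0) := by
      rw [normConst, div_mul_cancel₀ _ hf]
    have h1 : (∑ σ : Equiv.Perm (Fin n), weight θ σ / (normConst θ n * (n ! : ℝ≥0))) = 1 := by
      rw [← Finset.sum_div, hs, div_self (mul_ne_zero hn.ne' hf)]
    simp only [weightedMeasure, Measure.coe_finsetSum, Finset.sum_apply, Measure.smul_apply,
      measure_univ, smul_eq_mul, mul_one]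
    exact_mod_cast h1

/-- The polynomial `P(r) = r^(k+1) / (k+1) + ∑_{j=0}^k c_j r^j` with real coefficients. -/
noncomputable def logPoly (k : ℕ) (c : ℕ → ℝ) : Polynomial ℝ :=
  Polynomial.C (1 / ((k : ℝ) + 1)) * Polynomial.X ^ (k + 1)
    + ∑ j ∈ Finset.range (k + 1), Polynomial.C (c j) * Polynomial.X ^ j

/-- The standing analytic assumptions on the weights `θ`, with exponent `k`. The generating series
`g(t) = ∑_{m ≥ 1} (θ_m / m) t^m` converges to a holomorphic function on the open unit disc, `g`
extends continuously to the closed unit disc punctured at `1`, and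
`g(e^{-w}) = P(-log w) + O(w)` as `w → 0` with `Re w ≥ 0`, `w ≠ 0` (principal logarithm). -/
structure AdmissibleWeights (θ : ℕ → ℝ≥0) (k : ℕ) : Prop where
  one_le : 1 ≤ k
  exists_genFun : ∃ g : ℂ → ℂ,
    (∀ t : ℂ, ‖t‖ < 1 →
      HasSum (fun m : ℕ => (((θ (m + 1) : ℝ) / ((m : ℝ) + 1) : ℝ) : ℂ) * t ^ (m + 1)) (g t)) ∧
    DifferentiableOn ℂ g (Metric.ball 0 1) ∧
    ContinuousOn g (Metric.closedBall 0 1 \ {1}) ∧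
    ∃ c : ℕ → ℝ,
      (fun w : ℂ => g (Complex.exp (-w)) - Polynomial.aeval (-Complex.log w) (logPoly k c))
        =O[𝓝[{w : ℂ | 0 ≤ w.re ∧ w ≠ 0}] 0] (fun w : ℂ => w)

end LogCycles

/-! Grouping permutations by cycle type shows that `h_n` is the coefficient of `t^n` in `exp g`
(`coeff_exp_genFun`). For a prescribed vector `a` of counts of cycles of length at most `b`, the
remaining cycles form a permutation weighted by `θ` with `θ_1, …, θ_b` set to `0`. Hence `P(C = a)`
is exactly `∏ (θ_m/m)^{a_m} / a_m!` times `h'_{n-s} / h_n`, where `s = ∑ m a_m` and `h'` is the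
normalization for the truncated weights (`sum_weight_cycleCount_eq`). The Poisson limit therefore
reduces to `h'_{n-s} / h_n → e^{-q}` with `q = ∑_{m ≤ b} θ_m/m` (`tendsto_normConst_ratio`).

The coefficients are estimated by the saddle point method. In Cauchy's formula put `t = e^{-w}` with
`Re w = e^{-r}`, where `n = e^r P'(r)`, and write `w = e^{-r}(1 + is)`, `s = x/√P'(r)`, `L = log(1 +
is)`. Then `-log w = r - L`, and the exponent relative to its value at the saddle is about `P(r - L)
- P(r) + P'(r) i s`. To second order this is `P'(r)(is - L) ≈ -x²/2`; the error of order `r^{k-1}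
|L|²` vanishes because `P'(r) ~ r^k`. Dominated convergence (`tendsto_integral_saddleIntegrand`)
leaves a Gaussian integral.

Truncation subtracts from `g` a polynomial with value `q` at `t = 1`, so `P` becomes `P - q`: the
derivative and the saddle points are unchanged and the scale is multiplied by `e^{-q}`. The index
shift `s` only inserts `e^{-sw} → 1`. The ratio of the two asymptotics is the required limit. Since
the limit law lives on a countable space, convergence of point masses is enough. -/

namespace LogCycles

/-! ### Polynomial increments -/

/-- Second order Taylor bound for the monomials, uniform in the base point. -/
theorem norm_pow_taylor_le {a L : ℂ} {ρ : ℝ} (ha : ‖a‖ ≤ ρ) (hL : ‖L‖ ≤ ρ) (j : ℕ) :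
    ρ ^ 2 * ‖(a - L) ^ j - a ^ j + j * a ^ (j - 1) * L‖ ≤ 4 ^ j * ρ ^ j * ‖L‖ ^ 2 := by
  have hρ : 0 ≤ ρ := (norm_nonneg _).trans ha
  induction j with
  | zero => simp
  | succ j ih =>
    -- Multiplying the previous remainder by `a - L` gives the next one up to the term `j a^(j-1)
    -- L²`; the factor `j` makes the truncated exponent harmless at `j = 0`.
    have e : (a - L) ^ (j + 1) - a ^ (j + 1) + ((j + 1 : ℕ) : ℂ) * a ^ (j + 1 - 1) * L
        = (a - L) * ((a - L) ^ j - a ^ j + j * a ^ (j - 1) * L) + j * a ^ (j - 1) * L ^ 2 := by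
      rcases j with _ | j
      · simp
      · simp only [Nat.add_sub_cancel]; push_cast; ring
    have h1 : ‖a - L‖ ≤ 2 * ρ := (norm_sub_le _ _).trans (by linarith)
    have h2 : ρ ^ 2 * ‖(j : ℂ) * a ^ (j - 1) * L ^ 2‖ ≤ j * ρ ^ (j + 1) * ‖L‖ ^ 2 := by
      rcases j with _ | j
      · simp
      · rw [norm_mul, norm_mul, norm_pow, norm_pow, Complex.norm_natCast, Nat.add_sub_cancel]
        have : ‖a‖ ^ j ≤ ρ ^ j := by gcongr
        calc ρ ^ 2 * ((j + 1 : ℕ) * ‖a‖ ^ j * ‖L‖ ^ 2)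
            ≤ ρ ^ 2 * ((j + 1 : ℕ) * ρ ^ j * ‖L‖ ^ 2) := by gcongr
          _ = _ := by ring
    have h3 : (j : ℝ) ≤ 2 * 4 ^ j := by
      have : j < 4 ^ j := Nat.lt_pow_self (by norm_num)
      have : (j : ℝ) < 4 ^ j := by exact_mod_cast this
      linarith [pow_pos (show (0 : ℝ) < 4 by norm_num) j]
    rw [e]
    calc ρ ^ 2 * ‖(a - L) * ((a - L) ^ j - a ^ j + j * a ^ (j - 1) * L) + j * a ^ (j - 1) * L ^ 2‖
        ≤ ρ ^ 2 * (‖a - L‖ * ‖(a - L) ^ j - a ^ j + j * a ^ (j - 1) * L‖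
            + ‖(j : ℂ) * a ^ (j - 1) * L ^ 2‖) := by
          gcongr; exact (norm_add_le _ _).trans (by rw [norm_mul])
      _ = ‖a - L‖ * (ρ ^ 2 * ‖(a - L) ^ j - a ^ j + j * a ^ (j - 1) * L‖)
            + ρ ^ 2 * ‖(j : ℂ) * a ^ (j - 1) * L ^ 2‖ := by ring
      _ ≤ 2 * ρ * (4 ^ j * ρ ^ j * ‖L‖ ^ 2) + j * ρ ^ (j + 1) * ‖L‖ ^ 2 := by gcongr
      _ ≤ 2 * ρ * (4 ^ j * ρ ^ j * ‖L‖ ^ 2) + 2 * 4 ^ j * ρ ^ (j + 1) * ‖L‖ ^ 2 := by gcongr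
      _ = _ := by ring

/-- The monomial bounds are summed against the coefficients. As `ρ ≥ 1` and `k ≥ 1`, every `ρ^j` is
at most `ρ^(k-1) ρ²`, and the `ρ²` carried by `norm_pow_taylor_le` cancels. -/
theorem exists_norm_taylor_le {k : ℕ} (hk : 1 ≤ k) {P : Polynomial ℝ} (hd : P.natDegree ≤ k + 1) :
    ∃ C : ℝ, 0 ≤ C ∧ ∀ (a L : ℂ) (ρ : ℝ), 1 ≤ ρ → ‖a‖ ≤ ρ → ‖L‖ ≤ ρ →
      ‖Polynomial.aeval (a - L) P - Polynomial.aeval a P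
        + Polynomial.aeval a (Polynomial.derivative P) * L‖ ≤ C * ρ ^ (k - 1) * ‖L‖ ^ 2 := by
  refine ⟨∑ j ∈ Finset.range (k + 2), |P.coeff j| * 4 ^ j, by positivity, ?_⟩
  intro a L ρ hρ ha hL
  have h0 : 0 < ρ := by linarith
  have hd' : P.natDegree < k + 2 := by omega
  have e : Polynomial.aeval (a - L) P - Polynomial.aeval a P
        + Polynomial.aeval a (Polynomial.derivative P) * L
      = ∑ j ∈ Finset.range (k + 2), (P.coeff j : ℂ) *
          ((a - L) ^ j - a ^ j + j * a ^ (j - 1) * L) := by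
    have h3 : Polynomial.aeval a (Polynomial.derivative P)
        = ∑ j ∈ Finset.range (k + 2), (P.coeff j : ℂ) * (j * a ^ (j - 1)) := by
      conv_lhs => rw [P.as_sum_range' _ hd', map_sum, map_sum]
      refine Finset.sum_congr rfl fun j _ => ?_
      rw [Polynomial.derivative_monomial, Polynomial.aeval_monomial]
      simp [mul_assoc]
    rw [h3, Polynomial.aeval_eq_sum_range' hd', Polynomial.aeval_eq_sum_range' hd',
      ← Finset.sum_sub_distrib, Finset.sum_mul, ← Finset.sum_add_distrib]
    refine Finset.sum_congr rfl fun j _ => ?_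
    simp only [Complex.real_smul]; ring
  rw [e]
  refine (norm_sum_le _ _).trans ?_
  rw [Finset.sum_mul, Finset.sum_mul]
  refine Finset.sum_le_sum fun j hj => ?_
  have hj : j ≤ k + 1 := by have := Finset.mem_range.1 hj; omega
  rw [norm_mul, Complex.norm_real, Real.norm_eq_abs]
  rw [mul_assoc (|P.coeff j|), mul_assoc (|P.coeff j|)]
  refine mul_le_mul_of_nonneg_left ?_ (abs_nonneg _)
  refine le_of_mul_le_mul_left ((norm_pow_taylor_le ha hL j).trans ?_) (pow_pos h0 2)
  have : ρ ^ j ≤ ρ ^ (k - 1 + 2) := pow_le_pow_right₀ hρ (by omega)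
  calc 4 ^ j * ρ ^ j * ‖L‖ ^ 2 ≤ 4 ^ j * ρ ^ (k - 1 + 2) * ‖L‖ ^ 2 := by gcongr
    _ = _ := by ring

/-- The leading term contributes at least `(r - u) r^k / (k + 1)`, because `u^k ≤ r^k`. A monomial
of degree `j ≤ k` changes by at most `j r^(k-1) (r - u)`, which is of lower order. -/
theorem exists_le_eval_sub_eval {k : ℕ} {P : Polynomial ℝ} (hd : P.natDegree ≤ k + 1)
    (hlead : P.coeff (k + 1) = 1 / ((k : ℝ) + 1)) :
    ∃ C : ℝ, ∀ r u : ℝ, 1 ≤ r → 0 ≤ u → u ≤ r →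
      (r - u) * (r ^ k / (k + 1) - C * r ^ (k - 1)) ≤ P.eval r - P.eval u := by
  refine ⟨∑ j ∈ Finset.range (k + 1), |P.coeff j| * j, ?_⟩
  intro r u hr hu hur
  have hd' : P.natDegree < k + 2 := by omega
  rw [Polynomial.eval_eq_sum_range' hd', Polynomial.eval_eq_sum_range' hd',
    ← Finset.sum_sub_distrib, Finset.sum_range_succ (n := k + 1), hlead]
  have hs : 0 ≤ r - u := by linarith
  have h1 : (r - u) * r ^ k ≤ r ^ (k + 1) - u ^ (k + 1) := by
    have : u ^ k ≤ r ^ k := by gcongr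
    have := mul_le_mul_of_nonneg_left this hu
    rw [pow_succ, pow_succ]; nlinarith
  have h2 : ∀ j ∈ Finset.range (k + 1),
      -(|P.coeff j| * j * r ^ (k - 1) * (r - u)) ≤ P.coeff j * r ^ j - P.coeff j * u ^ j := by
    intro j hj
    have hj : j ≤ k := by have := Finset.mem_range.1 hj; omega
    have hle : u ^ j ≤ r ^ j := by gcongr
    have hd : r ^ j - u ^ j ≤ j * r ^ (k - 1) * (r - u) := by
      have : r ^ j - u ^ j ≤ j * r ^ (j - 1) * (r - u) := by
        clear hj hle
        clear hj
        induction j with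
        | zero => simp
        | succ j ih =>
          have e : (j : ℝ) * r ^ (j - 1) * r = j * r ^ j := by
            rcases j with _ | j
            · simp
            · simp only [Nat.add_sub_cancel]; ring
          have : r * (r ^ j - u ^ j) ≤ j * r ^ j * (r - u) := by
            calc r * (r ^ j - u ^ j) ≤ r * (j * r ^ (j - 1) * (r - u)) := by gcongr
              _ = (j * r ^ (j - 1) * r) * (r - u) := by ring
              _ = _ := by rw [e]
          have h4 : u ^ j * (r - u) ≤ r ^ j * (r - u) := by gcongr
          simp only [Nat.add_sub_cancel]; push_cast
          rw [pow_succ, pow_succ]; nlinarith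
      rcases j with _ | j
      · simp
      · refine this.trans ?_
        have : r ^ (j + 1 - 1) ≤ r ^ (k - 1) := pow_le_pow_right₀ hr (by omega)
        gcongr
    rw [← mul_sub]
    have h5 : |P.coeff j| * (r ^ j - u ^ j) ≤ |P.coeff j| * (j * r ^ (k - 1) * (r - u)) := by
      gcongr
    have h6 : -|P.coeff j| * (r ^ j - u ^ j) ≤ P.coeff j * (r ^ j - u ^ j) :=
      mul_le_mul_of_nonneg_right (neg_abs_le _) (by linarith)
    linarith
  have h3 := Finset.sum_le_sum h2
  rw [Finset.sum_neg_distrib, ← Finset.sum_mul, ← Finset.sum_mul] at h3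
  have hk : (0 : ℝ) < k + 1 := by positivity
  have h4 : (r - u) * (r ^ k / (k + 1))
      ≤ 1 / ((k : ℝ) + 1) * r ^ (k + 1) - 1 / ((k : ℝ) + 1) * u ^ (k + 1) := by
    rw [← mul_sub]
    calc (r - u) * (r ^ k / (k + 1)) = 1 / ((k : ℝ) + 1) * ((r - u) * r ^ k) := by ring
      _ ≤ _ := by gcongr
  linarith

theorem aeval_ofReal (Q : Polynomial ℝ) (x : ℝ) :
    Polynomial.aeval (x : ℂ) Q = ((Q.eval x : ℝ) : ℂ) := by
  simpa using Polynomial.aeval_algebraMap_apply ℂ x Q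

/-! ### The logarithm on the vertical line through 1, and decay of `Re P(r - L)` -/

theorem norm_one_add_mul_I (s : ℝ) : ‖1 + (s : ℂ) * Complex.I‖ = √(1 + s ^ 2) := by
  have := Complex.norm_add_mul_I 1 s
  simpa using this

theorem log_one_add_mul_I_re (s : ℝ) :
    (Complex.log (1 + s * Complex.I)).re = Real.log (1 + s ^ 2) / 2 := by
  rw [Complex.log_re, norm_one_add_mul_I, Real.log_sqrt (by positivity)]

theorem abs_log_one_add_mul_I_im_le (s : ℝ) :
    |(Complex.log (1 + s * Complex.I)).im| ≤ Real.pi / 2 := by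
  rw [Complex.log_im, Complex.abs_arg_le_pi_div_two_iff]; simp

/-- This lets errors quadratic in `Im L` be absorbed by decay linear in `Re L`. The angle `α = Im L`
satisfies `|α| ≤ |s|` and `α² ≤ 3`, so `log(1 + s²) ≥ log(1 + α²) ≥ α²/(1 + α²) ≥ α²/4`, while `Re L
= log(1 + s²)/2`. -/
theorem log_one_add_mul_I_im_sq_le (s : ℝ) :
    (Complex.log (1 + s * Complex.I)).im ^ 2 ≤ 8 * (Complex.log (1 + s * Complex.I)).re := by
  set α := (Complex.log (1 + s * Complex.I)).im with hα
  have h1 : |α| ≤ Real.pi / 2 := abs_log_one_add_mul_I_im_le s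
  -- Compare `cos α = 1/√(1 + s²)` with the general bound `cos α ≤ 1/√(1 + α²)`.
  have h2 : |α| ≤ |s| := by
    have hc : Real.cos α = 1 / √(1 + s ^ 2) := by
      have hne : (1 + (s : ℂ) * Complex.I) ≠ 0 := by
        intro h; have := congrArg Complex.re h; simp at this
      rw [hα, Complex.log_im, Complex.cos_arg hne, norm_one_add_mul_I]; simp
    have hle := Real.cos_le_one_div_sqrt_sq_add_one (x := α) ?_ ?_
    · rw [hc] at hle
      have h5 := (one_div_le_one_div (by positivity) (by positivity)).1 hle
      rw [Real.sqrt_le_sqrt_iff (by positivity)] at h5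
      exact sq_le_sq.1 (by linarith)
    · have := (abs_le.1 h1).1; linarith [Real.pi_pos]
    · have := (abs_le.1 h1).2; linarith [Real.pi_pos]
  rw [log_one_add_mul_I_re]
  have hsq : α ^ 2 ≤ s ^ 2 := sq_le_sq.2 h2
  have h3 : α ^ 2 ≤ 3 := by
    have : |α| ^ 2 ≤ (Real.pi / 2) ^ 2 := by gcongr
    rw [sq_abs] at this
    nlinarith [Real.pi_lt_d2, Real.pi_pos]
  have h4 : Real.log (1 + α ^ 2) ≤ Real.log (1 + s ^ 2) := by gcongr
  have h5 := Real.one_sub_inv_le_log_of_pos (show (0 : ℝ) < 1 + α ^ 2 by positivity)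
  have h6 : α ^ 2 / 4 ≤ 1 - (1 + α ^ 2)⁻¹ := by
    have : 1 - (1 + α ^ 2)⁻¹ = α ^ 2 / (1 + α ^ 2) := by field_simp; ring
    rw [this]
    gcongr; linarith
  linarith

/-- The displacement `L` is split. The real step from `r` to `r - Re L` gives the decay. The
imaginary step has a purely imaginary first-order term, so it changes the real part only by
`O(r^(k-1) (Im L)²) = O(r^(k-1) Re L)`. The bound `2 ≤ r` ensures `|Im L| ≤ π/2 ≤ r`. -/
theorem exists_aeval_sub_log_re_le {k : ℕ} (hk : 1 ≤ k) {P : Polynomial ℝ}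
    (hd : P.natDegree ≤ k + 1) (hlead : P.coeff (k + 1) = 1 / ((k : ℝ) + 1)) :
    ∃ C : ℝ, ∀ r s : ℝ, 2 ≤ r → (Complex.log (1 + s * Complex.I)).re ≤ r →
      (Polynomial.aeval (r - Complex.log (1 + s * Complex.I)) P).re - P.eval r ≤
        -((Complex.log (1 + s * Complex.I)).re * (r ^ k / (k + 1) - C * r ^ (k - 1))) := by
  obtain ⟨C₁, hC₁, h₁⟩ := exists_norm_taylor_le hk hd
  obtain ⟨C₂, h₂⟩ := exists_le_eval_sub_eval hd hlead
  refine ⟨8 * C₁ + C₂, ?_⟩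
  intro r s hr hl
  set L := Complex.log (1 + s * Complex.I) with hL
  have hl0 : 0 ≤ L.re := by
    rw [hL, log_one_add_mul_I_re]
    have := Real.log_nonneg (show 1 ≤ 1 + s ^ 2 by nlinarith)
    linarith
  have hα : |L.im| ≤ Real.pi / 2 := abs_log_one_add_mul_I_im_le s
  have hα2 : L.im ^ 2 ≤ 8 * L.re := log_one_add_mul_I_im_sq_le s
  have h3 := h₂ r (r - L.re) (by linarith) (by linarith) (by linarith)
  have h4 := h₁ ((r - L.re : ℝ) : ℂ) (L.im * Complex.I) r (by linarith)
    (by rw [Complex.norm_real, Real.norm_eq_abs, abs_le]; constructor <;> linarith)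
    (by
      rw [norm_mul, Complex.norm_I, Complex.norm_real, mul_one, Real.norm_eq_abs]
      linarith [Real.pi_lt_d2])
  have e1 : (((r - L.re : ℝ) : ℂ) - L.im * Complex.I) = r - L := by
    apply Complex.ext <;> simp
  rw [e1, aeval_ofReal, aeval_ofReal, norm_mul, Complex.norm_I, Complex.norm_real, mul_one, Real.norm_eq_abs,
    sq_abs] at h4
  have h5 := (Complex.abs_re_le_norm _).trans h4
  have e3 : (Polynomial.aeval (r - L) P - ((P.eval (r - L.re) : ℝ) : ℂ)
      + (((Polynomial.derivative P).eval (r - L.re) : ℝ) : ℂ) * (L.im * Complex.I)).re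
      = (Polynomial.aeval (r - L) P).re - P.eval (r - L.re) := by
    simp
  rw [e3] at h5
  have h6 := (abs_le.1 h5).2
  have h7 : C₁ * r ^ (k - 1) * L.im ^ 2 ≤ C₁ * r ^ (k - 1) * (8 * L.re) := by gcongr
  nlinarith

/-! ### Growth of `P` and `P'`, and the Gaussian limit of the exponent -/

theorem natDegree_eq_of_coeff {k : ℕ} {P : Polynomial ℝ} (hd : P.natDegree ≤ k + 1)
    (hlead : P.coeff (k + 1) = 1 / ((k : ℝ) + 1)) : P.natDegree = k + 1 :=
  Polynomial.natDegree_eq_of_le_of_coeff_ne_zero hd (by rw [hlead]; positivity)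

theorem tendsto_eval_derivative_div_pow {k : ℕ} {P : Polynomial ℝ} (hd : P.natDegree ≤ k + 1)
    (hlead : P.coeff (k + 1) = 1 / ((k : ℝ) + 1)) :
    Tendsto (fun r : ℝ => (Polynomial.derivative P).eval r / r ^ k) atTop (𝓝 1) := by
  have hdeg := natDegree_eq_of_coeff hd hlead
  have hc : (Polynomial.derivative P).coeff k = 1 := by
    rw [Polynomial.coeff_derivative, hlead]
    field_simp
  have hn : (Polynomial.derivative P).natDegree = k :=
    Polynomial.natDegree_eq_of_le_of_coeff_ne_zero
      ((Polynomial.natDegree_derivative_le P).trans (by omega)) (by rw [hc]; exact one_ne_zero)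
  have h0 : Polynomial.derivative P ≠ 0 := by
    intro h; rw [h] at hc; simp at hc
  have h := Polynomial.div_tendsto_atTop_leadingCoeff_div_of_degree_eq (Polynomial.derivative P)
    (Polynomial.X ^ k : Polynomial ℝ)
    (by rw [Polynomial.degree_X_pow, Polynomial.degree_eq_natDegree h0, hn])
  simpa [Polynomial.leadingCoeff, hn, hc] using h

theorem tendsto_eval_sub_mul {k : ℕ} (hk : 1 ≤ k) {P : Polynomial ℝ} (hd : P.natDegree ≤ k + 1)
    (hlead : P.coeff (k + 1) = 1 / ((k : ℝ) + 1)) (c : ℝ) :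
    Tendsto (fun r : ℝ => P.eval r - c * r) atTop atTop := by
  have hdeg := natDegree_eq_of_coeff hd hlead
  have h0 : P ≠ 0 := by
    rintro rfl; simp at hdeg
  have hlt : (Polynomial.C c * Polynomial.X).degree < P.degree := by
    refine (Polynomial.degree_C_mul_X_le c).trans_lt ?_
    rw [Polynomial.degree_eq_natDegree h0, hdeg]
    exact_mod_cast (by omega : 1 < k + 1)
  have h := (P - Polynomial.C c * Polynomial.X).tendsto_atTop_of_leadingCoeff_nonneg
    (by
      rw [Polynomial.degree_sub_eq_left_of_degree_lt hlt, Polynomial.degree_eq_natDegree h0, hdeg]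
      exact_mod_cast Nat.succ_pos k)
    (by
      rw [Polynomial.leadingCoeff_sub_of_degree_lt hlt, Polynomial.leadingCoeff, hdeg, hlead]
      positivity)
  simpa using h

theorem tendsto_eval_derivative {k : ℕ} (hk : 1 ≤ k) {P : Polynomial ℝ} (hd : P.natDegree ≤ k + 1)
    (hlead : P.coeff (k + 1) = 1 / ((k : ℝ) + 1)) :
    Tendsto (fun r : ℝ => (Polynomial.derivative P).eval r) atTop atTop := by
  have h := (tendsto_eval_derivative_div_pow hd hlead).pos_mul_atTop one_pos
    (tendsto_pow_atTop (α := ℝ) (n := k) (by omega))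
  refine h.congr' ?_
  filter_upwards [eventually_gt_atTop 0] with r hr
  field_simp

theorem tendsto_pow_div_eval_derivative {k : ℕ} (hk : 1 ≤ k) {P : Polynomial ℝ}
    (hd : P.natDegree ≤ k + 1) (hlead : P.coeff (k + 1) = 1 / ((k : ℝ) + 1)) :
    Tendsto (fun r : ℝ => r ^ (k - 1) / (Polynomial.derivative P).eval r) atTop (𝓝 0) := by
  have h := ((tendsto_eval_derivative_div_pow hd hlead).inv₀ one_ne_zero).mul tendsto_inv_atTop_zero
  rw [mul_zero] at h
  refine h.congr' ?_
  filter_upwards [eventually_gt_atTop 0,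
    (tendsto_eval_derivative hk hd hlead).eventually_gt_atTop 0] with r hr hl
  obtain ⟨m, rfl⟩ : ∃ m, k = m + 1 := ⟨k - 1, by omega⟩
  simp only [Nat.add_sub_cancel]
  field_simp
  rw [pow_succ']

theorem norm_log_one_add_sub_le {z : ℂ} (hz : ‖z‖ ≤ 1 / 2) :
    ‖Complex.log (1 + z) - z + z ^ 2 / 2‖ ≤ ‖z‖ ^ 3 := by
  have h := Complex.norm_log_sub_logTaylor_le 2 (show ‖z‖ < 1 by linarith)
  have e : Complex.logTaylor (2 + 1) z = z - z ^ 2 / 2 := by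
    simp [Complex.logTaylor, Finset.sum_range_succ]; ring
  rw [e] at h
  have h2 : (1 - ‖z‖)⁻¹ ≤ 2 := by
    rw [inv_le_comm₀ (by linarith) (by norm_num)]; linarith
  calc _ = ‖Complex.log (1 + z) - (z - z ^ 2 / 2)‖ := by ring_nf
    _ ≤ _ := h
    _ ≤ ‖z‖ ^ 3 * 2 / 2 := by
      norm_num
      have : 0 ≤ ‖z‖ ^ 3 := by positivity
      nlinarith
    _ = _ := by ring

/-- With `l = P'(r)` and `s = x/√l`, the exponent is the Taylor remainder of `P` minus `l (L - is)`.
The remainder is `O(r^(k-1) s²) = O(x² r^(k-1)/l)`. The expansion `L = is - (is)²/2 + O(|s|³)`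
yields `-l s²/2 = -x²/2` with error `|x|³/√l`. -/
theorem tendsto_saddle_exponent {k : ℕ} (hk : 1 ≤ k) {P : Polynomial ℝ}
    (hd : P.natDegree ≤ k + 1) (hlead : P.coeff (k + 1) = 1 / ((k : ℝ) + 1)) (x : ℝ) :
    Tendsto (fun r : ℝ =>
      (((Polynomial.derivative P).eval r : ℝ) : ℂ)
          * ((x / √((Polynomial.derivative P).eval r) : ℝ) * Complex.I)
        + Polynomial.aeval (r - Complex.log
            (1 + (x / √((Polynomial.derivative P).eval r) : ℝ) * Complex.I)) P
        - ((P.eval r : ℝ) : ℂ)) atTop (𝓝 ((-(x ^ 2 / 2) : ℝ) : ℂ)) := by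
  obtain ⟨C, hC, hT⟩ := exists_norm_taylor_le hk hd
  have hlam := tendsto_eval_derivative hk hd hlead
  have hsqrt : Tendsto (fun r : ℝ => √((Polynomial.derivative P).eval r)) atTop atTop :=
    Real.tendsto_sqrt_atTop.comp hlam
  have hbound : Tendsto (fun r : ℝ =>
      4 * C * x ^ 2 * (r ^ (k - 1) / (Polynomial.derivative P).eval r)
        + |x| ^ 3 * (√((Polynomial.derivative P).eval r))⁻¹) atTop (𝓝 0) := by
    have h := ((tendsto_pow_div_eval_derivative hk hd hlead).const_mul (4 * C * x ^ 2)).add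
      ((tendsto_inv_atTop_zero.comp hsqrt).const_mul (|x| ^ 3))
    simpa using h
  rw [tendsto_iff_norm_sub_tendsto_zero]
  refine squeeze_zero' (Eventually.of_forall fun _ => norm_nonneg _) ?_ hbound
  filter_upwards [hsqrt.eventually_ge_atTop (2 * |x|), hsqrt.eventually_gt_atTop 0,
    eventually_ge_atTop 1] with r h1 h2 hr
  set l := (Polynomial.derivative P).eval r with hl
  have hl0 : 0 < l := Real.sqrt_pos.1 h2
  set s := x / √l with hs
  have hss : |s| = |x| / √l := by rw [hs, abs_div, abs_of_pos h2]
  have hs2 : |s| ≤ 1 / 2 := by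
    rw [hss, div_le_iff₀ h2]; linarith
  have hsq : s ^ 2 = x ^ 2 / l := by rw [hs, div_pow, Real.sq_sqrt hl0.le]
  have hz : ‖(s : ℂ) * Complex.I‖ = |s| := by simp
  set L := Complex.log (1 + s * Complex.I) with hL
  have hL1 : ‖L‖ ≤ 2 * |s| := by
    have := Complex.norm_log_one_add_half_le_self (z := s * Complex.I) (by rw [hz]; exact hs2)
    rw [hz] at this
    linarith [abs_nonneg s]
  have h3 := hT r L r hr (by simp [abs_of_pos (show 0 < r by linarith)]) (by linarith)
  have h4 := norm_log_one_add_sub_le (z := s * Complex.I) (by rw [hz]; exact hs2)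
  rw [hz, ← hL] at h4
  rw [aeval_ofReal, aeval_ofReal, ← hl] at h3
  have hls : (l : ℂ) * (s : ℂ) ^ 2 = (x : ℂ) ^ 2 := by
    have : l * s ^ 2 = x ^ 2 := by rw [hsq]; field_simp
    exact_mod_cast this
  have e : (l : ℂ) * (s * Complex.I) + Polynomial.aeval (r - L) P - ((P.eval r : ℝ) : ℂ)
        - -((x ^ 2 / 2 : ℝ) : ℂ)
      = (Polynomial.aeval (r - L) P - ((P.eval r : ℝ) : ℂ) + l * L)
        - l * (L - s * Complex.I + (s * Complex.I) ^ 2 / 2) := by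
    rw [mul_pow, Complex.I_sq]
    push_cast
    linear_combination (1 / 2 : ℂ) * (- hls)
  have e' : ((-(x ^ 2 / 2) : ℝ) : ℂ) = -((x ^ 2 / 2 : ℝ) : ℂ) := by push_cast; ring
  simp only [e', e]
  have h5 : ‖(l : ℂ) * (L - s * Complex.I + (s * Complex.I) ^ 2 / 2)‖ ≤ l * |s| ^ 3 := by
    rw [norm_mul, Complex.norm_real, Real.norm_eq_abs, abs_of_pos hl0]
    gcongr
  have h6 : l * |s| ^ 3 = |x| ^ 3 * (√l)⁻¹ := by
    rw [hss, div_pow]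
    have : √l ^ 2 = l := Real.sq_sqrt hl0.le
    field_simp
    rw [this, mul_comm]
  have h7 : C * r ^ (k - 1) * ‖L‖ ^ 2 ≤ 4 * C * x ^ 2 * (r ^ (k - 1) / l) := by
    calc C * r ^ (k - 1) * ‖L‖ ^ 2 ≤ C * r ^ (k - 1) * (2 * |s|) ^ 2 := by gcongr
      _ = 4 * C * r ^ (k - 1) * s ^ 2 := by rw [mul_pow, sq_abs]; ring
      _ = _ := by rw [hsq]; ring
  refine (norm_sub_le _ _).trans ?_
  rw [← h6]
  linarith

/-! ### The saddle point integral -/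

/-- The point `e^{-r} (1 + i x / √P'(r))` of the vertical line through the saddle point `e^{-r}`. -/
noncomputable def saddlePath (P : Polynomial ℝ) (r x : ℝ) : ℂ :=
  (Real.exp (-r) : ℂ) * (1 + ((x / √((Polynomial.derivative P).eval r) : ℝ) : ℂ) * Complex.I)

/-- The normalized integrand of Cauchy's formula for the coefficients of `exp ∘ g`. -/
noncomputable def saddleIntegrand (g : ℂ → ℂ) (P : Polynomial ℝ) (j : ℕ) (r x : ℝ) : ℂ :=
  Complex.exp (g (Complex.exp (-saddlePath P r x)) - ((P.eval r : ℝ) : ℂ)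
    + (((Polynomial.derivative P).eval r : ℝ) : ℂ)
        * (((x / √((Polynomial.derivative P).eval r) : ℝ) : ℂ) * Complex.I)
    - j * saddlePath P r x)

theorem saddlePath_re (P : Polynomial ℝ) (r x : ℝ) : (saddlePath P r x).re = Real.exp (-r) := by
  rw [saddlePath, Complex.re_ofReal_mul]; simp

theorem saddlePath_im (P : Polynomial ℝ) (r x : ℝ) :
    (saddlePath P r x).im = Real.exp (-r) * (x / √((Polynomial.derivative P).eval r)) := by
  rw [saddlePath, Complex.im_ofReal_mul]; simp

theorem saddlePath_ne_zero (P : Polynomial ℝ) (r x : ℝ) : saddlePath P r x ≠ 0 := by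
  intro h
  have := saddlePath_re P r x
  rw [h, Complex.zero_re] at this
  exact (Real.exp_pos _).ne this

theorem log_saddlePath (P : Polynomial ℝ) (r x : ℝ) :
    -Complex.log (saddlePath P r x) = r - Complex.log
      (1 + ((x / √((Polynomial.derivative P).eval r) : ℝ) : ℂ) * Complex.I) := by
  have hne : (1 + ((x / √((Polynomial.derivative P).eval r) : ℝ) : ℂ) * Complex.I) ≠ 0 := by
    intro h; have := congrArg Complex.re h; simp at this
  rw [saddlePath, Complex.log_ofReal_mul (Real.exp_pos _) hne, Real.log_exp]
  push_cast; ring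

theorem continuous_saddlePath (P : Polynomial ℝ) (r : ℝ) : Continuous (saddlePath P r) := by
  unfold saddlePath; fun_prop

theorem continuous_saddleIntegrand {g : ℂ → ℂ} (hg : ContinuousOn g (Metric.ball 0 1))
    (P : Polynomial ℝ) (j : ℕ) (r : ℝ) : Continuous (saddleIntegrand g P j r) := by
  have h1 : Continuous fun x => Complex.exp (-saddlePath P r x) :=
    Complex.continuous_exp.comp (continuous_saddlePath P r).neg
  have h2 : Continuous fun x => g (Complex.exp (-saddlePath P r x)) := by
    refine hg.comp_continuous h1 fun x => ?_
    rw [mem_ball_zero_iff, Complex.norm_exp, Real.exp_lt_one_iff, Complex.neg_re, saddlePath_re]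
    exact neg_neg_of_pos (Real.exp_pos _)
  refine Complex.continuous_exp.comp (((h2.sub continuous_const).add ?_).sub
    (continuous_const.mul (continuous_saddlePath P r)))
  fun_prop

theorem exists_near_bound {g : ℂ → ℂ} {P : Polynomial ℝ}
    (hO : (fun w : ℂ => g (Complex.exp (-w)) - Polynomial.aeval (-Complex.log w) P)
        =O[𝓝[{w : ℂ | 0 ≤ w.re ∧ w ≠ 0}] 0] (fun w : ℂ => w)) :
    ∃ δ C : ℝ, 0 < δ ∧ δ ≤ 1 ∧ 0 ≤ C ∧ ∀ w : ℂ, 0 ≤ w.re → w ≠ 0 → ‖w‖ < δ →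
      ‖g (Complex.exp (-w)) - Polynomial.aeval (-Complex.log w) P‖ ≤ C * ‖w‖ := by
  obtain ⟨C, hC, h⟩ := hO.exists_nonneg
  rw [IsBigOWith, eventually_nhdsWithin_iff, Metric.eventually_nhds_iff] at h
  obtain ⟨ε, hε, h⟩ := h
  refine ⟨min ε 1, C, by positivity, min_le_right _ _, hC, fun w h1 h2 h3 => ?_⟩
  exact h (by rw [dist_zero_right]; exact h3.trans_le (min_le_left _ _)) ⟨h1, h2⟩

/-- In the strip `|Im w| ≤ π` the equation `e^{-w} = 1` forces `w = 0`. Removing the disc of radius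
`δ` from the rectangle therefore leaves a compact set on which `exp (g (e^{-w}))` is continuous. -/
theorem exists_far_bound {g : ℂ → ℂ} (hg : ContinuousOn g (Metric.closedBall 0 1 \ {1}))
    {δ : ℝ} (hδ : 0 < δ) :
    ∃ M : ℝ, 0 ≤ M ∧ ∀ w : ℂ, 0 ≤ w.re → w.re ≤ 1 → |w.im| ≤ Real.pi → δ ≤ ‖w‖ →
      ‖Complex.exp (g (Complex.exp (-w)))‖ ≤ M := by
  set K : Set ℂ := (Set.Icc 0 1 ×ℂ Set.Icc (-Real.pi) Real.pi) ∩ {w | δ ≤ ‖w‖} with hK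
  have hKc : IsCompact K :=
    (isCompact_Icc.reProdIm isCompact_Icc).inter_right (isClosed_le continuous_const continuous_norm)
  have hmap : Set.MapsTo (fun w : ℂ => Complex.exp (-w)) K (Metric.closedBall 0 1 \ {1}) := by
    rintro w ⟨hw, hn⟩
    rw [Complex.mem_reProdIm] at hw
    refine ⟨?_, ?_⟩
    · rw [mem_closedBall_zero_iff, Complex.norm_exp, Real.exp_le_one_iff, Complex.neg_re]
      linarith [hw.1.1]
    · intro h
      obtain ⟨m, hm⟩ := Complex.exp_eq_one_iff.1 (Set.mem_singleton_iff.1 h)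
      have hre : w.re = 0 := by simpa using congrArg Complex.re hm
      have him : -w.im = m * (2 * Real.pi) := by simpa using congrArg Complex.im hm
      have hm0 : m = 0 := by
        have h1 : |(m : ℝ)| * (2 * Real.pi) ≤ Real.pi := by
          have := abs_le.2 hw.2
          rw [← abs_neg, him, abs_mul, abs_of_pos (show 0 < 2 * Real.pi by positivity)] at this
          exact this
        by_contra h0
        have h2 : (1 : ℝ) ≤ |(m : ℝ)| := by exact_mod_cast Int.one_le_abs h0
        nlinarith [Real.pi_pos]
      rw [hm0] at him
      have hw0 : w = 0 := Complex.ext hre (by simpa using him)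
      rw [hw0] at hn
      simp at hn
      linarith
  have hcont : ContinuousOn (fun w : ℂ => Complex.exp (g (Complex.exp (-w)))) K :=
    (hg.comp (by fun_prop) hmap).cexp
  obtain ⟨M, hM⟩ := hKc.exists_bound_of_continuousOn hcont
  refine ⟨max M 0, le_max_right _ _, fun w h1 h2 h3 h4 => (hM w ⟨?_, h4⟩).trans (le_max_left _ _)⟩
  rw [Complex.mem_reProdIm]
  exact ⟨⟨h1, h2⟩, abs_le.1 h3⟩

theorem norm_saddleIntegrand_le (g : ℂ → ℂ) (P : Polynomial ℝ) (j : ℕ) (r x : ℝ) :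
    ‖saddleIntegrand g P j r x‖ ≤
      Real.exp ((g (Complex.exp (-saddlePath P r x))).re - P.eval r) := by
  rw [saddleIntegrand, Complex.norm_exp, Real.exp_le_exp]
  have h1 : ((((Polynomial.derivative P).eval r : ℝ) : ℂ)
        * (((x / √((Polynomial.derivative P).eval r) : ℝ) : ℂ) * Complex.I)).re = 0 := by
    rw [Complex.re_ofReal_mul]; simp
  have h2 : ((j : ℂ) * saddlePath P r x).re = j * Real.exp (-r) := by
    rw [← saddlePath_re P r x, ← Complex.ofReal_natCast, Complex.re_ofReal_mul]
  rw [Complex.sub_re, Complex.add_re, Complex.sub_re, h1, h2, Complex.ofReal_re]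
  have : 0 ≤ j * Real.exp (-r) := by positivity
  linarith

/-- An integrable majorant independent of `r`. Where `‖w‖ < δ`, the expansion of `g` gives a factor
`(1 + s²)^(-l/Λ)` with `l = P'(r)`, and Bernoulli's inequality turns it into `O(1/(1 + x²))`. Where
`‖w‖ ≥ δ`, `exp g` is bounded and `e^{-P(r)}` outweighs the polynomial factor, since `x²` is at most
`π² l e^{2r}`. -/
theorem eventually_norm_saddleIntegrand_le {k : ℕ} (hk : 1 ≤ k) {P : Polynomial ℝ}
    (hd : P.natDegree ≤ k + 1) (hlead : P.coeff (k + 1) = 1 / ((k : ℝ) + 1))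
    {g : ℂ → ℂ} (hg : ContinuousOn g (Metric.closedBall 0 1 \ {1}))
    (hO : (fun w : ℂ => g (Complex.exp (-w)) - Polynomial.aeval (-Complex.log w) P)
        =O[𝓝[{w : ℂ | 0 ≤ w.re ∧ w ≠ 0}] 0] (fun w : ℂ => w)) (j : ℕ) :
    ∃ B : ℝ, ∀ᶠ r : ℝ in atTop, ∀ x : ℝ,
      |x| ≤ Real.pi * (√((Polynomial.derivative P).eval r) * Real.exp r) →
        ‖saddleIntegrand g P j r x‖ ≤ B * (1 + x ^ 2)⁻¹ := by
  obtain ⟨δ, C, hδ, hδ1, hC, hnear⟩ := exists_near_bound hO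
  obtain ⟨M, hM, hfar⟩ := exists_far_bound hg hδ
  obtain ⟨C', hre⟩ := exists_aeval_sub_log_re_le hk hd hlead
  have hlam := tendsto_eval_derivative hk hd hlead
  -- Since `P'(r) ~ r^k`, the decay rate is about `P'(r)/(k + 1)`; this `Λ` asks for half of it,
  -- leaving room for the lower-order terms.
  set Λ : ℝ := 4 * (k + 1) with hΛ
  have hΛ1 : 1 ≤ Λ := by rw [hΛ]; have : (0 : ℝ) ≤ k := by positivity
                         linarith
  have hdecay : ∀ᶠ r : ℝ in atTop, 2 * (Polynomial.derivative P).eval r / Λ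
      ≤ r ^ k / (k + 1) - C' * r ^ (k - 1) := by
    have h1 : Tendsto (fun r : ℝ => ((Polynomial.derivative P).eval r / r ^ k)⁻¹ * (1 / (k + 1))
        - C' * (r ^ (k - 1) / (Polynomial.derivative P).eval r)) atTop
        (𝓝 (1⁻¹ * (1 / ((k : ℝ) + 1)) - C' * 0)) :=
      (((tendsto_eval_derivative_div_pow hd hlead).inv₀ one_ne_zero).mul_const _).sub
        ((tendsto_pow_div_eval_derivative hk hd hlead).const_mul C')
    have h2 : 2 / Λ < 1⁻¹ * (1 / ((k : ℝ) + 1)) - C' * 0 := by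
      have hk0 : (0 : ℝ) < k + 1 := by positivity
      rw [hΛ, mul_zero, sub_zero, inv_one, one_mul, div_lt_div_iff₀ (by positivity) hk0]
      linarith
    filter_upwards [h1.eventually_const_lt h2, hlam.eventually_gt_atTop 0,
      eventually_gt_atTop 0] with r h3 h4 h5
    have h6 := mul_le_mul_of_nonneg_left h3.le h4.le
    calc 2 * (Polynomial.derivative P).eval r / Λ
        = (Polynomial.derivative P).eval r * (2 / Λ) := by ring
      _ ≤ _ := h6
      _ = _ := by field_simp
  -- As `P'(r) ≤ e^r` eventually, the left side is `O(e^{3r})`, and `P(r) - 3r → ∞` because `P` has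
  -- degree at least 2.
  have hfarev : ∀ᶠ r : ℝ in atTop,
      M * (1 + Real.pi ^ 2 * ((Polynomial.derivative P).eval r * Real.exp r ^ 2))
        ≤ Real.exp (P.eval r) := by
    have h1 := (Real.tendsto_exp_atTop.comp
      (tendsto_eval_sub_mul hk hd hlead 3)).eventually_ge_atTop (M * (1 + Real.pi ^ 2))
    have h2 := (Polynomial.tendsto_div_exp_atTop (Polynomial.derivative P)).eventually_le_const
      (zero_lt_one)
    filter_upwards [h1, h2, eventually_ge_atTop 0] with r h3 h4 h5
    have h6 : (Polynomial.derivative P).eval r ≤ Real.exp r := by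
      rwa [div_le_one (Real.exp_pos r)] at h4
    have h7 : 1 ≤ Real.exp r := Real.one_le_exp h5
    simp only [Function.comp] at h3
    calc M * (1 + Real.pi ^ 2 * ((Polynomial.derivative P).eval r * Real.exp r ^ 2))
        ≤ M * (Real.exp r ^ 3 + Real.pi ^ 2 * (Real.exp r * Real.exp r ^ 2)) := by
          gcongr
          exact one_le_pow₀ h7
      _ = M * (1 + Real.pi ^ 2) * Real.exp r ^ 3 := by ring
      _ ≤ Real.exp (P.eval r - 3 * r) * Real.exp r ^ 3 := by gcongr
      _ = Real.exp (P.eval r) := by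
        rw [← Real.exp_nat_mul, ← Real.exp_add]; congr 1; push_cast; ring
  refine ⟨Real.exp C * Λ + 1, ?_⟩
  filter_upwards [hdecay, hfarev, hlam.eventually_ge_atTop Λ, eventually_ge_atTop 2]
    with r h1 h2 h3 h4 x hx
  refine (norm_saddleIntegrand_le g P j r x).trans ?_
  set l := (Polynomial.derivative P).eval r with hl
  have hl0 : 0 < l := by linarith
  have hsl : 0 < √l := Real.sqrt_pos.2 hl0
  set s := x / √l with hs
  set w := saddlePath P r x with hw
  have hwre : w.re = Real.exp (-r) := saddlePath_re P r x
  have hsq : s ^ 2 = x ^ 2 / l := by rw [hs, div_pow, Real.sq_sqrt hl0.le]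
  have hx0 : 0 < 1 + x ^ 2 := by positivity
  rcases lt_or_ge ‖w‖ δ with hcase | hcase
  · have hlog := log_saddlePath P r x
    rw [← hw, ← hl, ← hs] at hlog
    have h5 := hnear w (by rw [hwre]; positivity) (saddlePath_ne_zero P r x) hcase
    rw [hlog] at h5
    set L := Complex.log (1 + (s : ℂ) * Complex.I) with hL
    have hLre : L.re ≤ r := by
      have h6 := congrArg Complex.re hlog
      rw [Complex.neg_re, Complex.sub_re, Complex.log_re, Complex.ofReal_re] at h6
      have h7 : Real.log ‖w‖ ≤ 0 := Real.log_nonpos (norm_nonneg _) (by linarith)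
      linarith
    have h6 := hre r s h4 hLre
    rw [← hL] at h6
    have h7 := (abs_le.1 ((Complex.abs_re_le_norm _).trans h5)).2
    rw [Complex.sub_re] at h7
    have h8 : C * ‖w‖ ≤ C := mul_le_of_le_one_right hC (by linarith)
    have hL2 : L.re = Real.log (1 + s ^ 2) / 2 := log_one_add_mul_I_re s
    have hlog0 : 0 ≤ Real.log (1 + s ^ 2) := Real.log_nonneg (by nlinarith)
    have h9 : L.re * (2 * l / Λ) ≤ L.re * (r ^ k / (k + 1) - C' * r ^ (k - 1)) :=
      mul_le_mul_of_nonneg_left h1 (by rw [hL2]; linarith)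
    have h10 : L.re * (2 * l / Λ) = Real.log (1 + s ^ 2) * (l / Λ) := by rw [hL2]; ring
    -- Bernoulli's inequality, available because `l ≥ Λ`; combined with `l s² = x²` it removes the
    -- dependence on `r`.
    have hb : 1 + l / Λ * s ^ 2 ≤ (1 + s ^ 2) ^ (l / Λ) :=
      one_add_mul_self_le_rpow_one_add (by nlinarith [sq_nonneg s])
        (by rw [one_le_div (by linarith)]; exact h3)
    have hb2 : (1 + x ^ 2) / Λ ≤ 1 + l / Λ * s ^ 2 := by
      rw [hsq, show l / Λ * (x ^ 2 / l) = x ^ 2 / Λ by field_simp, add_div]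
      have : 1 / Λ ≤ 1 := by rw [div_le_one (by linarith)]; exact hΛ1
      linarith
    calc Real.exp ((g (Complex.exp (-w))).re - P.eval r)
        ≤ Real.exp (C + -(Real.log (1 + s ^ 2) * (l / Λ))) := by
          rw [Real.exp_le_exp]; linarith
      _ = Real.exp C * ((1 + s ^ 2) ^ (l / Λ))⁻¹ := by
          rw [Real.exp_add, Real.exp_neg, Real.rpow_def_of_pos (by positivity)]
      _ ≤ Real.exp C * ((1 + x ^ 2) / Λ)⁻¹ := by
          gcongr
          exact hb2.trans hb
      _ = Real.exp C * Λ * (1 + x ^ 2)⁻¹ := by rw [inv_div]; ring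
      _ ≤ _ := by gcongr; linarith
  · have him : |w.im| ≤ Real.pi := by
      rw [hw, saddlePath_im, ← hl, abs_mul, abs_of_pos (Real.exp_pos _), abs_div,
        abs_of_pos hsl, Real.exp_neg, inv_mul_le_iff₀ (Real.exp_pos _), div_le_iff₀ hsl]
      linarith
    have h5 := hfar w (by rw [hwre]; positivity)
      (by rw [hwre, Real.exp_le_one_iff]; linarith) him hcase
    rw [Complex.norm_exp] at h5
    have hx2 : x ^ 2 ≤ Real.pi ^ 2 * (l * Real.exp r ^ 2) := by
      have : |x| ^ 2 ≤ (Real.pi * (√l * Real.exp r)) ^ 2 := by gcongr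
      rwa [sq_abs, mul_pow, mul_pow, Real.sq_sqrt hl0.le] at this
    have h6 : M * (1 + x ^ 2) ≤ Real.exp (P.eval r) :=
      (mul_le_mul_of_nonneg_left (by linarith) hM).trans h2
    have h7 : Real.exp ((g (Complex.exp (-w))).re - P.eval r) ≤ (1 + x ^ 2)⁻¹ := by
      rw [Real.exp_sub, div_le_iff₀ (Real.exp_pos _), inv_mul_eq_div, le_div_iff₀ hx0]
      exact (mul_le_mul_of_nonneg_right h5 hx0.le).trans h6
    refine h7.trans (le_mul_of_one_le_left (by positivity) ?_)
    have : 0 ≤ Real.exp C * Λ := by positivity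
    linarith

theorem tendsto_saddleIntegrand {k : ℕ} (hk : 1 ≤ k) {P : Polynomial ℝ}
    (hd : P.natDegree ≤ k + 1) (hlead : P.coeff (k + 1) = 1 / ((k : ℝ) + 1))
    {g : ℂ → ℂ}
    (hO : (fun w : ℂ => g (Complex.exp (-w)) - Polynomial.aeval (-Complex.log w) P)
        =O[𝓝[{w : ℂ | 0 ≤ w.re ∧ w ≠ 0}] 0] (fun w : ℂ => w)) (j : ℕ) (x : ℝ) :
    Tendsto (fun r => saddleIntegrand g P j r x) atTop
      (𝓝 ((Real.exp (-(x ^ 2 / 2)) : ℝ) : ℂ)) := by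
  obtain ⟨δ, C, hδ, hδ1, hC, hnear⟩ := exists_near_bound hO
  have hlam := tendsto_eval_derivative hk hd hlead
  have hw : Tendsto (fun r => saddlePath P r x) atTop (𝓝 0) := by
    have h1 : Tendsto (fun r => x / √((Polynomial.derivative P).eval r)) atTop (𝓝 0) :=
      (Real.tendsto_sqrt_atTop.comp hlam).const_div_atTop x
    have h2 : Tendsto (fun r : ℝ => Real.exp (-r)) atTop (𝓝 0) := Real.tendsto_exp_neg_atTop_nhds_zero
    have h1' := (Complex.continuous_ofReal.tendsto 0).comp h1
    have h2' := (Complex.continuous_ofReal.tendsto 0).comp h2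
    have := h2'.mul ((h1'.mul_const Complex.I).const_add 1)
    simpa [saddlePath, Function.comp_def] using this
  have herr : Tendsto (fun r => g (Complex.exp (-saddlePath P r x))
      - Polynomial.aeval (-Complex.log (saddlePath P r x)) P) atTop (𝓝 0) := by
    refine squeeze_zero_norm' ?_ (by simpa using hw.norm.const_mul C)
    have hsmall : ∀ᶠ r in atTop, ‖saddlePath P r x‖ < δ :=
      hw.norm.eventually_lt_const (by simpa using hδ)
    filter_upwards [hsmall] with r hr
    exact hnear _ (by rw [saddlePath_re]; positivity) (saddlePath_ne_zero P r x) hr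
  have hs := tendsto_saddle_exponent hk hd hlead x
  have htot := (herr.add hs).sub (hw.const_mul (j : ℂ))
  rw [zero_add, mul_zero, sub_zero] at htot
  rw [Complex.ofReal_exp]
  refine ((Complex.continuous_exp.tendsto _).comp htot).congr fun r => ?_
  simp only [Function.comp, saddleIntegrand]
  congr 1
  rw [log_saddlePath]
  ring

/-- The endpoints are the values of `x` at which the imaginary part of the path equals `±π`, so the
range is one full turn of the circle. They tend to infinity, and dominated convergence gives the
full Gaussian integral. -/
theorem tendsto_integral_saddleIntegrand {k : ℕ} (hk : 1 ≤ k) {P : Polynomial ℝ}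
    (hd : P.natDegree ≤ k + 1) (hlead : P.coeff (k + 1) = 1 / ((k : ℝ) + 1))
    {g : ℂ → ℂ} (hg : ContinuousOn g (Metric.closedBall 0 1 \ {1}))
    (hO : (fun w : ℂ => g (Complex.exp (-w)) - Polynomial.aeval (-Complex.log w) P)
        =O[𝓝[{w : ℂ | 0 ≤ w.re ∧ w ≠ 0}] 0] (fun w : ℂ => w)) (j : ℕ) :
    Tendsto (fun r : ℝ =>
      ∫ x in (-(Real.pi * (√((Polynomial.derivative P).eval r) * Real.exp r)))..
        (Real.pi * (√((Polynomial.derivative P).eval r) * Real.exp r)), saddleIntegrand g P j r x)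
      atTop (𝓝 ((√(2 * Real.pi) : ℝ) : ℂ)) := by
  have hlam := tendsto_eval_derivative hk hd hlead
  have hball : ContinuousOn g (Metric.ball 0 1) := hg.mono fun z hz => by
    refine ⟨Metric.ball_subset_closedBall hz, ?_⟩
    rintro rfl
    simp at hz
  obtain ⟨B, hB⟩ := eventually_norm_saddleIntegrand_le hk hd hlead hg hO j
  set c : ℝ → ℝ := fun r => Real.pi * (√((Polynomial.derivative P).eval r) * Real.exp r) with hc
  have hc0 : ∀ r, 0 ≤ c r := fun r => by positivity
  have hctop : Tendsto c atTop atTop :=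
    ((Real.tendsto_sqrt_atTop.comp hlam).atTop_mul_atTop₀ Real.tendsto_exp_atTop).const_mul_atTop
      Real.pi_pos
  have hgauss : ∫ x : ℝ, ((Real.exp (-(x ^ 2 / 2)) : ℝ) : ℂ) = ((√(2 * Real.pi) : ℝ) : ℂ) := by
    have h := integral_gaussian (1 / 2)
    rw [integral_complex_ofReal]
    congr 1
    rw [show √(2 * Real.pi) = √(Real.pi / (1 / 2)) by congr 1; ring, ← h]
    congr 1; ext x; congr 1; ring
  rw [← hgauss]
  have key : Tendsto (fun r : ℝ => ∫ x : ℝ,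
      (Set.Ioc (-(c r)) (c r)).indicator (saddleIntegrand g P j r) x) atTop
      (𝓝 (∫ x : ℝ, ((Real.exp (-(x ^ 2 / 2)) : ℝ) : ℂ))) := by
    refine tendsto_integral_filter_of_dominated_convergence (fun x => B * (1 + x ^ 2)⁻¹) ?_ ?_
      (integrable_inv_one_add_sq.const_mul B) ?_
    · exact Eventually.of_forall fun r =>
        (continuous_saddleIntegrand hball P j r).aestronglyMeasurable.indicator measurableSet_Ioc
    · filter_upwards [hB] with r hr
      refine ae_of_all _ fun x => ?_
      by_cases hx : x ∈ Set.Ioc (-(c r)) (c r)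
      · rw [Set.indicator_of_mem hx]
        exact hr x (abs_le.2 ⟨hx.1.le, hx.2⟩)
      · rw [Set.indicator_of_notMem hx, norm_zero]
        have h0 := (norm_nonneg _).trans (hr 0 (by rw [abs_zero]; exact hc0 r))
        have hB0 : 0 ≤ B := by simpa using h0
        positivity
    · refine ae_of_all _ fun x => ?_
      refine (tendsto_saddleIntegrand hk hd hlead hO j x).congr' ?_
      filter_upwards [hctop.eventually_gt_atTop |x|] with r hr
      rw [Set.indicator_of_mem]
      exact ⟨(abs_lt.1 hr).1, (abs_lt.1 hr).2.le⟩
  refine key.congr fun r => ?_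
  rw [integral_indicator measurableSet_Ioc, intervalIntegral.integral_of_le]
  linarith [hc0 r]

/-! ### Cauchy's formula and the asymptotics of coefficients -/

theorem iteratedDeriv_eq_integral {G : ℂ → ℂ} (hG : DifferentiableOn ℂ G (Metric.ball 0 1))
    (m : ℕ) {ρ : ℝ} (hρ : 0 < ρ) :
    iteratedDeriv m G 0 / (m ! : ℂ) = (2 * Real.pi : ℂ)⁻¹ *
      ∫ t in (-Real.pi)..Real.pi, G (Complex.exp (-(ρ + t * Complex.I)))
        * Complex.exp (m * (ρ + t * Complex.I)) := by
  have hR : Real.exp (-ρ) < 1 := by rw [Real.exp_lt_one_iff]; linarith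
  have hsub : Metric.closedBall (0 : ℂ) (Real.exp (-ρ)) ⊆ Metric.ball 0 1 :=
    Metric.closedBall_subset_ball hR
  have h := (hG.mono hsub).circleIntegral_one_div_sub_center_pow_smul (Real.exp_pos _) m
  set f : ℝ → ℂ := fun t => G (Complex.exp (-(ρ + t * Complex.I)))
        * Complex.exp (m * (ρ + t * Complex.I)) with hf
  have hz : ∀ θ : ℝ, circleMap 0 (Real.exp (-ρ)) θ
      = Complex.exp (-(ρ + ((-θ : ℝ) : ℂ) * Complex.I)) := by
    intro θ
    rw [circleMap, zero_add, Complex.ofReal_exp, ← Complex.exp_add]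
    congr 1; push_cast; ring
  have hfz : ∀ θ : ℝ, f (-θ) = G (circleMap 0 (Real.exp (-ρ)) θ)
      * (circleMap 0 (Real.exp (-ρ)) θ ^ m)⁻¹ := by
    intro θ
    simp only [hf]
    rw [hz, ← Complex.exp_nat_mul, ← Complex.exp_neg]
    congr 2; ring
  have hint : ∀ θ : ℝ, deriv (circleMap 0 (Real.exp (-ρ))) θ •
      ((1 / (circleMap 0 (Real.exp (-ρ)) θ - 0) ^ (m + 1)) • G (circleMap 0 (Real.exp (-ρ)) θ))
      = Complex.I * f (-θ) := by
    intro θ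
    have hne : circleMap 0 (Real.exp (-ρ)) θ ≠ 0 := circleMap_ne_center (Real.exp_pos _).ne'
    rw [deriv_circleMap, sub_zero, hfz, pow_succ]
    simp only [smul_eq_mul]
    field_simp
  rw [circleIntegral] at h
  simp_rw [hint] at h
  rw [intervalIntegral.integral_const_mul, smul_eq_mul] at h
  -- The substitution `z = e^{-w}` reverses the orientation of the circle; periodicity and the
  -- reflection `θ ↦ -θ` bring the integral back to `[-π, π]`.
  have hper : Function.Periodic (fun θ => f (-θ)) (2 * Real.pi) := by
    intro θ
    simp only [hfz, periodic_circleMap 0 (Real.exp (-ρ)) θ]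
  have hshift := hper.intervalIntegral_add_eq 0 (-Real.pi)
  have hneg := intervalIntegral.integral_comp_neg (a := -Real.pi) (b := Real.pi) f
  rw [zero_add, show -Real.pi + 2 * Real.pi = Real.pi by ring, hneg, neg_neg] at hshift
  rw [hshift] at h
  have hm : (m ! : ℂ) ≠ 0 := by exact_mod_cast m.factorial_ne_zero
  have hpi : (Real.pi : ℂ) ≠ 0 := by exact_mod_cast Real.pi_ne_zero
  have hI := Complex.I_ne_zero
  have h' : Complex.I * ∫ x in (-Real.pi)..Real.pi, f x
      = Complex.I * (2 * Real.pi * (iteratedDeriv m G 0 / (m ! : ℂ))) := by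
    rw [h]; ring
  rw [mul_left_cancel₀ hI h']
  field_simp

/-- The order of magnitude of the `n`-th coefficient when `n = e^r P'(r)`. -/
noncomputable def saddleScale (P : Polynomial ℝ) (r : ℝ) : ℝ :=
  Real.exp (P.eval r + (Polynomial.derivative P).eval r - r)
    / √((Polynomial.derivative P).eval r)

theorem saddleScale_pos {P : Polynomial ℝ} {r : ℝ} (h : 0 < (Polynomial.derivative P).eval r) :
    0 < saddleScale P r :=
  div_pos (Real.exp_pos _) (Real.sqrt_pos.2 h)

/-- The substitution `t = e^{-r} x/√P'(r)` in Cauchy's formula. The saddle point is that of index `m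
+ j`, not `m`: then `m w = P'(r)(1 + is) - j w`, so that coefficients with different shifts `j`
share one scale. -/
theorem coeff_eq_saddleScale_mul {g : ℂ → ℂ} (hg : DifferentiableOn ℂ g (Metric.ball 0 1))
    {P : Polynomial ℝ} {r : ℝ} (hl : 0 < (Polynomial.derivative P).eval r) {m j : ℕ}
    (hmj : Real.exp r * (Polynomial.derivative P).eval r = ((m + j : ℕ) : ℝ)) :
    iteratedDeriv m (fun z => Complex.exp (g z)) 0 / (m ! : ℂ)
      = (saddleScale P r : ℂ) * ((2 * Real.pi : ℂ)⁻¹ *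
        ∫ x in (-(Real.pi * (√((Polynomial.derivative P).eval r) * Real.exp r)))..
          (Real.pi * (√((Polynomial.derivative P).eval r) * Real.exp r)),
          saddleIntegrand g P j r x) := by
  set l := (Polynomial.derivative P).eval r with hldef
  have hsl : 0 < √l := Real.sqrt_pos.2 hl
  have hρ : 0 < Real.exp (-r) := Real.exp_pos _
  rw [iteratedDeriv_eq_integral hg.cexp m hρ]
  have hc : Real.exp (-r) / √l ≠ 0 := by positivity
  have hsub := intervalIntegral.integral_comp_mul_left
    (a := -(Real.pi * (√l * Real.exp r))) (b := Real.pi * (√l * Real.exp r))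
    (fun t : ℝ => Complex.exp (g (Complex.exp (-((Real.exp (-r) : ℝ) + t * Complex.I))))
        * Complex.exp (m * ((Real.exp (-r) : ℝ) + t * Complex.I))) hc
  have hbd : Real.exp (-r) / √l * (Real.pi * (√l * Real.exp r)) = Real.pi := by
    rw [Real.exp_neg]; field_simp
  rw [mul_neg, hbd] at hsub
  have hsub' := congrArg (fun z => (Real.exp (-r) / √l) • z) hsub
  simp only [smul_smul, mul_inv_cancel₀ hc, one_smul] at hsub'
  rw [← hsub']
  have hn : ((m : ℂ) + j) * (Real.exp (-r) : ℝ) = (l : ℝ) := by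
    have : ((m : ℝ) + j) * Real.exp (-r) = l := by
      push_cast at hmj
      rw [← hmj, Real.exp_neg]; field_simp
    exact_mod_cast this
  have hpt : ∀ x : ℝ, Complex.exp (g (Complex.exp (-((Real.exp (-r) : ℝ)
          + ((Real.exp (-r) / √l * x : ℝ) : ℂ) * Complex.I))))
        * Complex.exp (m * ((Real.exp (-r) : ℝ) + ((Real.exp (-r) / √l * x : ℝ) : ℂ) * Complex.I))
      = Complex.exp ((P.eval r + l : ℝ)) * saddleIntegrand g P j r x := by
    intro x
    have hw : ((Real.exp (-r) : ℝ) : ℂ) + ((Real.exp (-r) / √l * x : ℝ) : ℂ) * Complex.I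
        = saddlePath P r x := by
      rw [saddlePath, ← hldef]; push_cast; ring
    have hmw : (m : ℂ) * saddlePath P r x
        = l + l * (((x / √l : ℝ) : ℂ) * Complex.I) - j * saddlePath P r x := by
      have : ((m : ℂ) + j) * saddlePath P r x
          = l * (1 + ((x / √l : ℝ) : ℂ) * Complex.I) := by
        rw [saddlePath, ← hldef, ← mul_assoc, hn]
      linear_combination this
    rw [hw, saddleIntegrand, ← Complex.exp_add, ← Complex.exp_add, hmw, ← hldef]
    congr 1
    push_cast; ring
  simp_rw [hpt]
  rw [intervalIntegral.integral_const_mul, saddleScale, ← hldef, Real.exp_sub,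
    Complex.real_smul, ← Complex.ofReal_exp]
  have : (Real.exp (-r) / √l : ℝ) * Real.exp (P.eval r + l)
      = Real.exp (P.eval r + l) / Real.exp r / √l := by
    rw [Real.exp_neg]; ring
  rw [← this]
  push_cast
  ring

theorem tendsto_coeff_div_saddleScale {k : ℕ} (hk : 1 ≤ k) {P : Polynomial ℝ}
    (hd : P.natDegree ≤ k + 1) (hlead : P.coeff (k + 1) = 1 / ((k : ℝ) + 1))
    {g : ℂ → ℂ} (hdiff : DifferentiableOn ℂ g (Metric.ball 0 1))
    (hg : ContinuousOn g (Metric.closedBall 0 1 \ {1}))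
    (hO : (fun w : ℂ => g (Complex.exp (-w)) - Polynomial.aeval (-Complex.log w) P)
        =O[𝓝[{w : ℂ | 0 ≤ w.re ∧ w ≠ 0}] 0] (fun w : ℂ => w))
    {a : ℕ → ℝ} (ha : ∀ m, iteratedDeriv m (fun z => Complex.exp (g z)) 0 / (m ! : ℂ) = a m)
    {r : ℕ → ℝ} (hr : Tendsto r atTop atTop)
    (hrn : ∀ᶠ n : ℕ in atTop, Real.exp (r n) * (Polynomial.derivative P).eval (r n) = n) (j : ℕ) :
    Tendsto (fun n => a (n - j) / saddleScale P (r n)) atTop (𝓝 ((√(2 * Real.pi))⁻¹)) := by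
  have h := ((tendsto_integral_saddleIntegrand hk hd hlead hg hO j).comp hr).const_mul
    ((2 * Real.pi : ℂ)⁻¹)
  have e : (2 * Real.pi : ℂ)⁻¹ * ((√(2 * Real.pi) : ℝ) : ℂ) = (((√(2 * Real.pi))⁻¹ : ℝ) : ℂ) := by
    have : (2 * Real.pi)⁻¹ * √(2 * Real.pi) = (√(2 * Real.pi))⁻¹ := by
      rw [inv_mul_eq_div, Real.sqrt_div_self]
    exact_mod_cast this
  rw [e] at h
  refine (Complex.continuous_re.tendsto _ |>.comp h).congr' ?_
  filter_upwards [hrn, hr.eventually ((tendsto_eval_derivative hk hd hlead).eventually_gt_atTop 0),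
    eventually_ge_atTop j] with n h1 h2 h3
  have h4 := coeff_eq_saddleScale_mul hdiff h2 (m := n - j) (j := j)
    (by rw [h1, Nat.sub_add_cancel h3])
  rw [ha] at h4
  have h5 : (saddleScale P (r n) : ℂ) ≠ 0 := by exact_mod_cast (saddleScale_pos h2).ne'
  have h6 := eq_div_of_mul_eq h5 ((mul_comm _ _).trans h4.symm)
  rw [← Complex.ofReal_div] at h6
  exact (congrArg Complex.re h6).trans (Complex.ofReal_re _)

/-- The intermediate value theorem gives solutions `r n ≥ 0` once `n` exceeds the value at `0`. They
diverge because `e^r P'(r)` is bounded on each `[0, b]`. -/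
theorem exists_saddle_seq {k : ℕ} (hk : 1 ≤ k) {P : Polynomial ℝ}
    (hd : P.natDegree ≤ k + 1) (hlead : P.coeff (k + 1) = 1 / ((k : ℝ) + 1)) :
    ∃ r : ℕ → ℝ, Tendsto r atTop atTop ∧
      ∀ᶠ n : ℕ in atTop, Real.exp (r n) * (Polynomial.derivative P).eval (r n) = n := by
  set F : ℝ → ℝ := fun r => Real.exp r * (Polynomial.derivative P).eval r with hF
  have hFc : Continuous F := by fun_prop
  have hFt : Tendsto F atTop atTop :=
    Real.tendsto_exp_atTop.atTop_mul_atTop₀ (tendsto_eval_derivative hk hd hlead)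
  have hex : ∀ n : ℕ, F 0 ≤ n → ∃ r, 0 ≤ r ∧ F r = n := by
    intro n hn
    obtain ⟨b, hb, hb0⟩ := ((hFt.eventually_ge_atTop (n : ℝ)).and (eventually_ge_atTop 0)).exists
    obtain ⟨r, hr, hrn⟩ := intermediate_value_Icc hb0 hFc.continuousOn ⟨hn, hb⟩
    exact ⟨r, hr.1, hrn⟩
  have hex' : ∀ n : ℕ, ∃ r, F 0 ≤ n → 0 ≤ r ∧ F r = n := by
    intro n
    by_cases hn : F 0 ≤ n
    · obtain ⟨r, hr⟩ := hex n hn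
      exact ⟨r, fun _ => hr⟩
    · exact ⟨0, fun h => absurd h hn⟩
  choose r hr using hex'
  have hev : ∀ᶠ n : ℕ in atTop, F 0 ≤ n := tendsto_natCast_atTop_atTop.eventually_ge_atTop (F 0)
  refine ⟨r, ?_, hev.mono fun n hn => (hr n hn).2⟩
  rw [tendsto_atTop]
  intro b
  obtain ⟨M, hM⟩ := (isCompact_Icc (a := (0 : ℝ)) (b := b)).exists_bound_of_continuousOn
    hFc.continuousOn
  filter_upwards [hev, tendsto_natCast_atTop_atTop.eventually_gt_atTop M] with n h1 h2
  by_contra hlt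
  obtain ⟨h3, h4⟩ := hr n h1
  have := hM (r n) ⟨h3, (not_le.1 hlt).le⟩
  rw [h4, Real.norm_eq_abs] at this
  linarith [le_abs_self (n : ℝ)]

/-! ### From permutations to weighted partitions -/

theorem prod_toFinset_count_eq {M : Multiset ℕ} {s : Finset ℕ} (h : M.toFinset ⊆ s)
    (f : ℕ → ℕ → ℝ) (hf : ∀ m, f m 0 = 1) :
    ∏ m ∈ M.toFinset, f m (M.count m) = ∏ m ∈ s, f m (M.count m) := by
  refine Finset.prod_subset h fun m _ hm => ?_
  rw [Multiset.count_eq_zero.2 (by simpa using hm), hf]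

/-- Cauchy's formula: the number of permutations with a given cycle structure. -/
theorem card_partition_eq_mul {α : Type*} [Fintype α] [DecidableEq α]
    (p : (Fintype.card α).Partition) :
    ((Finset.univ.filter fun σ : Equiv.Perm α => σ.partition = p).card : ℝ)
      * (p.parts.prod * ∏ m ∈ p.parts.toFinset, ((p.parts.count m)! : ℝ))
      = ((Fintype.card α)! : ℝ) := by
  set M := p.parts.filter (fun n => 2 ≤ n) with hM
  -- `cycleType` omits fixed points, which `partition` records as parts equal to 1; `c` is their
  -- number and contributes the factor `c!`.
  set c := Fintype.card α - M.sum with hc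
  have hsplit : p.parts = M + Multiset.replicate (p.parts.filter fun n => ¬ 2 ≤ n).card 1 := by
    have h1 : p.parts.filter (fun n => ¬ 2 ≤ n)
        = Multiset.replicate (p.parts.filter fun n => ¬ 2 ≤ n).card 1 := by
      refine Multiset.eq_replicate_card.2 fun b hb => ?_
      rw [Multiset.mem_filter] at hb
      have := p.parts_pos hb.1
      omega
    rw [← h1, hM, Multiset.filter_add_not]
  have hcard : (p.parts.filter fun n => ¬ 2 ≤ n).card = c := by
    have := congrArg Multiset.sum hsplit
    rw [p.parts_sum, Multiset.sum_add, Multiset.sum_replicate] at this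
    simp only [smul_eq_mul, mul_one] at this
    omega
  rw [hcard] at hsplit
  have hM2 : ∀ a ∈ M, 2 ≤ a := fun a ha => (Multiset.mem_filter.1 ha).2
  have hset : (Finset.univ.filter fun σ : Equiv.Perm α => σ.partition = p)
      = Finset.univ.filter fun σ : Equiv.Perm α => σ.cycleType = M := by
    ext σ
    simp only [Finset.mem_filter, Finset.mem_univ, true_and]
    constructor
    · rintro rfl
      exact Equiv.Perm.filter_parts_partition_eq_cycleType.symm
    · intro h
      rw [Nat.Partition.ext_iff, Equiv.Perm.parts_partition, ← Equiv.Perm.sum_cycleType, h,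
        hsplit]
  have hle : M.sum ≤ Fintype.card α := by
    have := congrArg Multiset.sum hsplit
    rw [p.parts_sum, Multiset.sum_add] at this
    omega
  have hcount := Equiv.Perm.card_of_cycleType_mul_eq α M
  rw [if_pos ⟨hle, hM2⟩] at hcount
  have hprod : p.parts.prod = M.prod := by
    rw [hsplit]; simp
  have h1M : 1 ∉ M := fun h => by have := hM2 1 h; omega
  have hsub : p.parts.toFinset ⊆ insert 1 M.toFinset := by
    intro a ha
    rw [Multiset.mem_toFinset, hsplit, Multiset.mem_add] at ha
    rw [Finset.mem_insert, Multiset.mem_toFinset]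
    exact ha.symm.imp_left Multiset.eq_of_mem_replicate
  have hfac : ∏ m ∈ p.parts.toFinset, ((p.parts.count m)! : ℝ)
      = (c ! : ℝ) * ∏ m ∈ M.toFinset, ((M.count m)! : ℝ) := by
    rw [prod_toFinset_count_eq hsub (fun _ j => (j ! : ℝ)) (by simp),
      Finset.prod_insert (by simpa using h1M)]
    congr 1
    · rw [hsplit, Multiset.count_add, Multiset.count_eq_zero.2 h1M, Multiset.count_replicate_self,
        zero_add]
    · refine Finset.prod_congr rfl fun m hm => ?_
      have hm1 : (1 : ℕ) ≠ m := by
        rintro rfl; exact h1M (by simpa using hm)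
      rw [hsplit, Multiset.count_add, Multiset.count_replicate, if_neg hm1, add_zero]
  rw [hset, hprod, hfac, ← hcount]
  push_cast
  ring

theorem sum_perm_eq {α : Type*} [Fintype α] [DecidableEq α] {N : ℕ} (hN : Fintype.card α = N)
    (f : Multiset ℕ → ℝ) :
    (∑ σ : Equiv.Perm α, f σ.partition.parts) / (N ! : ℝ) = ∑ p : N.Partition,
      f p.parts / (p.parts.prod * ∏ m ∈ p.parts.toFinset, ((p.parts.count m)! : ℝ)) := by
  subst hN
  rw [← Finset.sum_fiberwise' Finset.univ (fun σ : Equiv.Perm α => σ.partition)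
    (fun p => f p.parts), Finset.sum_div]
  refine Finset.sum_congr rfl fun p _ => ?_
  rw [Finset.sum_const, nsmul_eq_mul, ← card_partition_eq_mul p]
  have h := card_partition_eq_mul p
  have hne : ((Fintype.card α)! : ℝ) ≠ 0 := by exact_mod_cast Nat.factorial_ne_zero _
  rw [← h] at hne
  have h1 := left_ne_zero_of_mul hne
  rw [mul_div_mul_left _ _ h1]

/-- The weight `∏_m (θ_m / m)^{c_m} / c_m!` of a multiset with multiplicities `c_m`. -/
noncomputable def multisetWeight (θ : ℕ → ℝ≥0) (M : Multiset ℕ) : ℝ :=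
  ∏ m ∈ M.toFinset, ((θ m : ℝ) / m) ^ M.count m / (M.count m)!

theorem multisetWeight_eq_prod (θ : ℕ → ℝ≥0) {M : Multiset ℕ} {s : Finset ℕ}
    (h : M.toFinset ⊆ s) :
    multisetWeight θ M = ∏ m ∈ s, ((θ m : ℝ) / m) ^ M.count m / (M.count m)! :=
  prod_toFinset_count_eq h (fun m j => ((θ m : ℝ) / m) ^ j / j !) (by simp)

theorem parts_toFinset_subset {n : ℕ} (p : n.Partition) : p.parts.toFinset ⊆ Finset.Icc 1 n := by
  intro m hm
  rw [Multiset.mem_toFinset] at hm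
  exact Finset.mem_Icc.2 ⟨p.parts_pos hm, p.le_of_mem_parts hm⟩

theorem sum_weight_mul_eq (θ : ℕ → ℝ≥0) (n : ℕ) (f : Multiset ℕ → ℝ) :
    (∑ σ : Equiv.Perm (Fin n), (weight θ σ : ℝ) * f σ.partition.parts) / (n ! : ℝ)
      = ∑ p : n.Partition, multisetWeight θ p.parts * f p.parts := by
  have h := sum_perm_eq (Fintype.card_fin n)
    (fun M => (∏ m ∈ Finset.Icc 1 n, (θ m : ℝ) ^ M.count m) * f M)
  have e : ∀ σ : Equiv.Perm (Fin n), (weight θ σ : ℝ)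
      = ∏ m ∈ Finset.Icc 1 n, (θ m : ℝ) ^ σ.partition.parts.count m := by
    intro σ; simp [weight, cycleCount]
  simp_rw [e]
  rw [h]
  refine Finset.sum_congr rfl fun p _ => ?_
  have hp : (p.parts.prod : ℝ) = ∏ m ∈ p.parts.toFinset, (m : ℝ) ^ p.parts.count m := by
    rw [Finset.prod_multiset_count]; push_cast; rfl
  rw [hp, ← prod_toFinset_count_eq (parts_toFinset_subset p) (fun m j => (θ m : ℝ) ^ j) (by simp),
    mul_div_right_comm, ← Finset.prod_mul_distrib, ← Finset.prod_div_distrib, multisetWeight]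
  congr 1
  refine Finset.prod_congr rfl fun m _ => ?_
  rw [div_pow, div_div]

theorem normConst_eq_sum (θ : ℕ → ℝ≥0) (n : ℕ) :
    (normConst θ n : ℝ) = ∑ p : n.Partition, multisetWeight θ p.parts := by
  have h := sum_weight_mul_eq θ n (fun _ => 1)
  simp only [mul_one] at h
  rw [← h, normConst]
  push_cast
  rfl

theorem normConst_zero (θ : ℕ → ℝ≥0) : normConst θ 0 = 1 := by
  simp [normConst, weight]

/-- Removing the sub-multiset `A` is a bijection from the partitions that contain `A` onto the
partitions of the difference. -/
theorem sum_partition_sub (A : Multiset ℕ) (hA : ∀ a ∈ A, 0 < a) {n N : ℕ} (hN : n + A.sum = N)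
    (f : Multiset ℕ → ℝ) :
    ∑ p : N.Partition, (if A ≤ p.parts then f (p.parts - A) else 0)
      = ∑ q : n.Partition, f q.parts := by
  rw [← Finset.sum_filter]
  refine Finset.sum_bij'
    (fun p hp => (⟨p.parts - A,
        fun hi => p.parts_pos (Multiset.mem_of_le (Multiset.sub_le_self _ _) hi), by
      have h := (Finset.mem_filter.1 hp).2
      have h1 := congrArg Multiset.sum (Multiset.sub_add_cancel h)
      rw [Multiset.sum_add, p.parts_sum] at h1
      omega⟩ : n.Partition))
    (fun q _ => (⟨q.parts + A, fun hi => (Multiset.mem_add.1 hi).elim q.parts_pos (hA _), by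
      rw [Multiset.sum_add, q.parts_sum, hN]⟩ : N.Partition)) ?_ ?_ ?_ ?_ ?_
  · intro p _; exact Finset.mem_univ _
  · intro q _
    exact Finset.mem_filter.2 ⟨Finset.mem_univ _, Multiset.le_add_left _ _⟩
  · intro p hp
    exact Nat.Partition.ext (Multiset.sub_add_cancel (Finset.mem_filter.1 hp).2)
  · intro q _
    exact Nat.Partition.ext (Multiset.add_sub_cancel_right)
  · intro p _; rfl

/-- With `y = θ_m/m` and `c` the multiplicity of `m`, this is `c y^c/c! = y · y^(c-1)/(c-1)!`,
multiplied by `m`. -/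
theorem count_mul_multisetWeight (θ : ℕ → ℝ≥0) {m : ℕ} (hm : 0 < m) (M : Multiset ℕ) :
    (M.count m * m : ℝ) * multisetWeight θ M
      = θ m * (if {m} ≤ M then multisetWeight θ (M - {m}) else 0) := by
  have hm0 : (m : ℝ) ≠ 0 := by exact_mod_cast hm.ne'
  by_cases h : m ∈ M
  · rw [if_pos (Multiset.singleton_le.2 h)]
    have hmem : m ∈ M.toFinset := by simpa using h
    have hsub : (M - {m}).toFinset ⊆ M.toFinset := by
      intro a ha
      rw [Multiset.mem_toFinset] at ha ⊢
      exact Multiset.mem_of_le (Multiset.sub_le_self _ _) ha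
    rw [multisetWeight_eq_prod θ hsub, multisetWeight, ← Finset.mul_prod_erase _ _ hmem,
      ← Finset.mul_prod_erase _ _ hmem, ← mul_assoc, ← mul_assoc]
    obtain ⟨c, hc⟩ : ∃ c, M.count m = c + 1 :=
      ⟨M.count m - 1, by have := Multiset.count_pos.2 h; omega⟩
    congr 1
    · rw [Multiset.count_sub, hc, Multiset.count_singleton_self, Nat.add_sub_cancel,
        Nat.factorial_succ]
      have : (c ! : ℝ) ≠ 0 := by exact_mod_cast c.factorial_ne_zero
      push_cast
      rw [pow_succ]
      field_simp
    · refine Finset.prod_congr rfl fun a ha => ?_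
      have : a ≠ m := Finset.ne_of_mem_erase ha
      rw [Multiset.count_sub, Multiset.count_singleton, if_neg this, Nat.sub_zero]
  · rw [if_neg (by rwa [Multiset.singleton_le]), Multiset.count_eq_zero.2 h]
    simp

/-- Writing `n + 1` as the sum of the parts and removing one part of each size. This is the
differential equation `G' = g' G` read on coefficients. -/
theorem normConst_recurrence (θ : ℕ → ℝ≥0) (n : ℕ) :
    ((n : ℝ) + 1) * normConst θ (n + 1)
      = ∑ i ∈ Finset.range (n + 1), (θ (i + 1) : ℝ) * normConst θ (n - i) := by
  have h1 : ∀ p : (n + 1).Partition, ((n : ℝ) + 1) * multisetWeight θ p.parts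
      = ∑ i ∈ Finset.range (n + 1), (θ (i + 1) : ℝ) *
        (if {i + 1} ≤ p.parts then multisetWeight θ (p.parts - {i + 1}) else 0) := by
    intro p
    have hs : ((n : ℝ) + 1) = ∑ i ∈ Finset.range (n + 1),
        (p.parts.count (i + 1) * (i + 1 : ℕ) : ℝ) := by
      have h2 := Finset.sum_multiset_count_of_subset p.parts (Finset.Icc 1 (n + 1))
        (parts_toFinset_subset p)
      rw [p.parts_sum] at h2
      rw [Finset.range_eq_Ico, Finset.sum_Ico_add' (fun i => (p.parts.count i * (i : ℕ) : ℝ)) 0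
        (n + 1) 1]
      have e : Finset.Ico (0 + 1) (n + 1 + 1) = Finset.Icc 1 (n + 1) := by ext; simp
      rw [e]
      exact_mod_cast h2
    rw [hs, Finset.sum_mul]
    exact Finset.sum_congr rfl fun i _ => count_mul_multisetWeight θ i.succ_pos _
  rw [normConst_eq_sum, Finset.mul_sum, Finset.sum_congr rfl fun p _ => h1 p, Finset.sum_comm]
  refine Finset.sum_congr rfl fun i hi => ?_
  have hi : i ≤ n := by have := Finset.mem_range.1 hi; omega
  rw [← Finset.mul_sum, sum_partition_sub {i + 1} (by simp) (n := n - i) (by simp; omega),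
    normConst_eq_sum]

/-! ### Prescribing the numbers of short cycles -/

/-- The weights `θ` with `θ_1, …, θ_b` replaced by `0`. -/
noncomputable def zeroUpTo (θ : ℕ → ℝ≥0) (b m : ℕ) : ℝ≥0 := if m ≤ b then 0 else θ m

/-- The multiset that contains `j + 1` exactly `a j` times, for `j < b`. -/
def prescribed {b : ℕ} (a : Fin b → ℕ) : Multiset ℕ :=
  ∑ j : Fin b, Multiset.replicate (a j) (j + 1)

theorem mem_prescribed {b : ℕ} {a : Fin b → ℕ} {m : ℕ} (hm : m ∈ prescribed a) :
    0 < m ∧ m ≤ b := by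
  rw [prescribed, Multiset.mem_sum] at hm
  obtain ⟨j, _, hj⟩ := hm
  rw [Multiset.eq_of_mem_replicate hj]
  omega

theorem count_prescribed {b : ℕ} (a : Fin b → ℕ) (j : Fin b) :
    (prescribed a).count ((j : ℕ) + 1) = a j := by
  rw [prescribed, Multiset.count_sum', Finset.sum_eq_single j]
  · simp
  · intro i _ hi
    rw [Multiset.count_replicate, if_neg]
    intro h
    exact hi (Fin.ext (by omega))
  · simp

theorem multisetWeight_prescribed (θ : ℕ → ℝ≥0) {b : ℕ} (a : Fin b → ℕ) :
    multisetWeight θ (prescribed a)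
      = ∏ j : Fin b, ((θ (j + 1) : ℝ) / ((j : ℝ) + 1)) ^ a j / (a j)! := by
  have hsub : (prescribed a).toFinset ⊆ Finset.Ico (0 + 1) (b + 1) := by
    intro m hm
    have := mem_prescribed (Multiset.mem_toFinset.1 hm)
    rw [Finset.mem_Ico]; omega
  rw [multisetWeight_eq_prod θ hsub, ← Finset.prod_Ico_add' _ 0 b 1, ← Finset.range_eq_Ico,
    Finset.prod_range]
  refine Finset.prod_congr rfl fun j _ => ?_
  rw [count_prescribed]
  push_cast
  rfl

/-- Exact equality of the small counts can be replaced by containment of `prescribed a`: any surplus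
part of size at most `b` survives in the difference, where its truncated weight is `0`. Containment
is the form that `sum_partition_sub` can sum. -/
theorem multisetWeight_mul_indicator (θ : ℕ → ℝ≥0) {b : ℕ} (a : Fin b → ℕ) {M : Multiset ℕ}
    (hM : ∀ m ∈ M, 0 < m) :
    multisetWeight θ M * (if (fun j : Fin b => M.count ((j : ℕ) + 1)) = a then 1 else 0)
      = multisetWeight θ (prescribed a) *
        (if prescribed a ≤ M then multisetWeight (zeroUpTo θ b) (M - prescribed a) else 0) := by
  by_cases hle : prescribed a ≤ M
  · rw [if_pos hle]
    by_cases heq : (fun j : Fin b => M.count ((j : ℕ) + 1)) = a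
    · rw [if_pos heq, mul_one]
      have h1 : (prescribed a).toFinset ⊆ M.toFinset := Multiset.toFinset_subset.2
        (Multiset.subset_of_le hle)
      have h2 : (M - prescribed a).toFinset ⊆ M.toFinset := Multiset.toFinset_subset.2
        (Multiset.subset_of_le (Multiset.sub_le_self _ _))
      rw [multisetWeight_eq_prod θ h1, multisetWeight_eq_prod _ h2, multisetWeight,
        ← Finset.prod_mul_distrib]
      refine Finset.prod_congr rfl fun m hm => ?_
      have hm0 := hM m (Multiset.mem_toFinset.1 hm)
      rw [Multiset.count_sub]
      by_cases hmb : m ≤ b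
      · have h3 : M.count m = (prescribed a).count m := by
          have h4 := congrFun heq ⟨m - 1, by omega⟩
          have h5 := count_prescribed a ⟨m - 1, by omega⟩
          simp only [Nat.sub_add_cancel hm0] at h4 h5
          rw [h4, h5]
        rw [h3]; simp
      · have h3 : (prescribed a).count m = 0 :=
          Multiset.count_eq_zero.2 fun h => hmb (mem_prescribed h).2
        rw [h3, zeroUpTo, if_neg hmb]; simp
    · rw [if_neg heq, mul_zero, eq_comm]
      have : ∃ j : Fin b, M.count ((j : ℕ) + 1) ≠ a j := by
        by_contra! h
        exact heq (funext h)
      obtain ⟨j, hj⟩ := this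
      have hlt : a j < M.count ((j : ℕ) + 1) := by
        have := Multiset.count_le_of_le ((j : ℕ) + 1) hle
        rw [count_prescribed] at this
        omega
      have hc : (M - prescribed a).count ((j : ℕ) + 1) ≠ 0 := by
        rw [Multiset.count_sub, count_prescribed]; omega
      have hmem : ((j : ℕ) + 1) ∈ (M - prescribed a).toFinset := by
        rw [Multiset.mem_toFinset]
        by_contra h
        exact hc (Multiset.count_eq_zero.2 h)
      rw [multisetWeight, multisetWeight, Finset.prod_eq_zero hmem, mul_zero]
      rw [zeroUpTo, if_pos (by omega)]
      rw [NNReal.coe_zero, zero_div, zero_pow hc, zero_div]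
  · rw [if_neg hle, if_neg, mul_zero, mul_zero]
    intro h
    refine hle (Multiset.le_iff_count.2 fun m => ?_)
    by_cases hm : m ∈ prescribed a
    · obtain ⟨h0, hb⟩ := mem_prescribed hm
      have h4 := congrFun h ⟨m - 1, by omega⟩
      have h5 := count_prescribed a ⟨m - 1, by omega⟩
      simp only [Nat.sub_add_cancel h0] at h4 h5
      rw [h4, h5]
    · rw [Multiset.count_eq_zero.2 hm]; exact Nat.zero_le _

theorem sum_weight_cycleCount_eq (θ : ℕ → ℝ≥0) {b : ℕ} (a : Fin b → ℕ) {n : ℕ}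
    (hn : (prescribed a).sum ≤ n) :
    (∑ σ : Equiv.Perm (Fin n), (weight θ σ : ℝ) *
        (if (fun j : Fin b => cycleCount ((j : ℕ) + 1) σ) = a then 1 else 0)) / (n ! : ℝ)
      = multisetWeight θ (prescribed a) * normConst (zeroUpTo θ b) (n - (prescribed a).sum) := by
  have h := sum_weight_mul_eq θ n
    (fun M => if (fun j : Fin b => M.count ((j : ℕ) + 1)) = a then 1 else 0)
  refine h.trans ?_
  rw [Finset.sum_congr rfl fun p _ => multisetWeight_mul_indicator θ a fun m hm => p.parts_pos hm,
    ← Finset.mul_sum, sum_partition_sub _ (fun m hm => (mem_prescribed hm).1)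
      (Nat.sub_add_cancel hn), normConst_eq_sum]

/-! ### The generating function of the normalization constants -/

theorem iteratedDeriv_genFun {θ : ℕ → ℝ≥0} {g : ℂ → ℂ}
    (hsum : ∀ t : ℂ, ‖t‖ < 1 →
      HasSum (fun m : ℕ => (((θ (m + 1) : ℝ) / ((m : ℝ) + 1) : ℝ) : ℂ) * t ^ (m + 1)) (g t))
    (hg : DifferentiableOn ℂ g (Metric.ball 0 1)) (m : ℕ) :
    iteratedDeriv (m + 1) g 0 = m ! * θ (m + 1) := by
  have han : AnalyticAt ℂ g 0 :=
    hg.analyticAt (Metric.ball_mem_nhds 0 one_pos)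
  set c : ℕ → ℂ := fun m => (((θ m : ℝ) / (m : ℝ) : ℝ) : ℂ) with hc
  have h1 : HasFPowerSeriesAt g (FormalMultilinearSeries.ofScalars ℂ c) 0 := by
    rw [hasFPowerSeriesAt_iff]
    filter_upwards [Metric.ball_mem_nhds (0 : ℂ) one_pos] with z hz
    rw [zero_add, ← hasSum_nat_add_iff' 1]
    have h := hsum z (by simpa using hz)
    simp only [FormalMultilinearSeries.coeff_ofScalars, Finset.range_one, Finset.sum_singleton,
      smul_eq_mul, hc]
    simpa [mul_comm] using h
  have h2 := han.hasFPowerSeriesAt.eq_formalMultilinearSeries h1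
  have h3 := congrArg (fun p => FormalMultilinearSeries.coeff p (m + 1)) h2
  simp only [FormalMultilinearSeries.coeff_ofScalars, hc] at h3
  have hm : ((m ! : ℕ) : ℂ) ≠ 0 := by exact_mod_cast m.factorial_ne_zero
  have hm1 : ((m : ℂ) + 1) ≠ 0 := by exact_mod_cast m.succ_ne_zero
  rw [div_eq_iff (by exact_mod_cast (m + 1).factorial_ne_zero), Nat.factorial_succ] at h3
  rw [h3]
  push_cast
  field_simp

/-- By Leibniz's rule, `G' = g' G` for `G = exp g` gives the Taylor coefficients the recurrence of
`normConst_recurrence`; both sequences start at `1` because `g 0 = 0`. -/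
theorem coeff_exp_genFun {θ : ℕ → ℝ≥0} {g : ℂ → ℂ}
    (hsum : ∀ t : ℂ, ‖t‖ < 1 →
      HasSum (fun m : ℕ => (((θ (m + 1) : ℝ) / ((m : ℝ) + 1) : ℝ) : ℂ) * t ^ (m + 1)) (g t))
    (hg : DifferentiableOn ℂ g (Metric.ball 0 1)) (n : ℕ) :
    iteratedDeriv n (fun z => Complex.exp (g z)) 0 / (n ! : ℂ) = ((normConst θ n : ℝ) : ℂ) := by
  have hball : Metric.ball (0 : ℂ) 1 ∈ 𝓝 0 := Metric.ball_mem_nhds 0 one_pos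
  have han : AnalyticAt ℂ g 0 := hg.analyticAt hball
  set G : ℂ → ℂ := fun z => Complex.exp (g z) with hG
  have hGan : AnalyticAt ℂ G 0 := han.cexp
  have hderiv : deriv G =ᶠ[𝓝 0] deriv g * G := by
    filter_upwards [Metric.isOpen_ball.mem_nhds (Metric.mem_ball_self (x := (0 : ℂ)) one_pos)]
      with z hz
    have hd : DifferentiableAt ℂ g z := hg.differentiableAt (Metric.isOpen_ball.mem_nhds hz)
    rw [hG, deriv_cexp hd, Pi.mul_apply, mul_comm]
  induction n using Nat.strong_induction_on with
  | _ n ih =>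
    rcases n with _ | n
    · have h0 : g 0 = 0 := by
        have h := hsum 0 (by simp)
        simp only [ne_eq, Nat.add_eq_zero_iff, one_ne_zero, and_false, not_false_eq_true, zero_pow,
          mul_zero] at h
        exact h.unique hasSum_zero
      simp [hG, h0, normConst_zero]
    · have hfac : ∀ m : ℕ, ((m ! : ℕ) : ℂ) ≠ 0 := fun m => by exact_mod_cast m.factorial_ne_zero
      have hn1 : ((n : ℂ) + 1) ≠ 0 := by exact_mod_cast n.succ_ne_zero
      rw [iteratedDeriv_succ', hderiv.iteratedDeriv_eq,
        iteratedDeriv_mul han.deriv.contDiffAt hGan.contDiffAt]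
      have hrec : ((n : ℂ) + 1) * ((normConst θ (n + 1) : ℝ) : ℂ)
          = ∑ i ∈ Finset.range (n + 1), ((θ (i + 1) : ℝ) : ℂ) * ((normConst θ (n - i) : ℝ) : ℂ) := by
        exact_mod_cast congrArg (fun x : ℝ => (x : ℂ)) (normConst_recurrence θ n)
      rw [div_eq_iff (hfac _), Nat.factorial_succ]
      have hterm : ∀ i ∈ Finset.range (n + 1),
          (n.choose i : ℂ) * iteratedDeriv i (deriv g) 0 * iteratedDeriv (n - i) G 0
            = n ! * (((θ (i + 1) : ℝ) : ℂ) * ((normConst θ (n - i) : ℝ) : ℂ)) := by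
        intro i hi
        have hi : i ≤ n := by have := Finset.mem_range.1 hi; omega
        rw [← iteratedDeriv_succ', iteratedDeriv_genFun hsum hg, ← ih (n - i) (by omega)]
        have hch : (n.choose i : ℂ) * i ! * (n - i)! = n ! := by
          exact_mod_cast Nat.choose_mul_factorial_mul_factorial hi
        rw [← hch]
        have := hfac (n - i)
        field_simp
      rw [Finset.sum_congr rfl hterm, ← Finset.mul_sum, ← hrec]
      push_cast
      ring

/-! ### Comparing the full and the truncated weights -/

theorem logPoly_natDegree_le (k : ℕ) (c : ℕ → ℝ) : (logPoly k c).natDegree ≤ k + 1 := by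
  refine Polynomial.natDegree_add_le_of_degree_le (Polynomial.natDegree_C_mul_X_pow_le _ _) ?_
  refine Polynomial.natDegree_sum_le_of_forall_le _ _ fun j hj => ?_
  have := Finset.mem_range.1 hj
  exact (Polynomial.natDegree_C_mul_X_pow_le _ _).trans (by omega)

theorem logPoly_coeff (k : ℕ) (c : ℕ → ℝ) :
    (logPoly k c).coeff (k + 1) = 1 / ((k : ℝ) + 1) := by
  rw [logPoly, Polynomial.coeff_add, Polynomial.finsetSum_coeff,
    Finset.sum_eq_zero fun j hj => ?_, add_zero, Polynomial.coeff_C_mul_X_pow, if_pos rfl]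
  have := Finset.mem_range.1 hj
  rw [Polynomial.coeff_C_mul_X_pow, if_neg (by omega)]

theorem hasSum_zeroUpTo {θ : ℕ → ℝ≥0} {t s : ℂ} (b : ℕ)
    (hsum : HasSum (fun m : ℕ => (((θ (m + 1) : ℝ) / ((m : ℝ) + 1) : ℝ) : ℂ) * t ^ (m + 1)) s) :
    HasSum (fun m : ℕ => (((zeroUpTo θ b (m + 1) : ℝ) / ((m : ℝ) + 1) : ℝ) : ℂ) * t ^ (m + 1))
      (s - ∑ m ∈ Finset.range b,
        (((θ (m + 1) : ℝ) / ((m : ℝ) + 1) : ℝ) : ℂ) * t ^ (m + 1)) := by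
  have h := hsum.sub (hasSum_sum_of_ne_finset_zero (s := Finset.range b)
    (f := fun m : ℕ => if m < b then
      (((θ (m + 1) : ℝ) / ((m : ℝ) + 1) : ℝ) : ℂ) * t ^ (m + 1) else 0)
    (fun m hm => if_neg (by simpa using hm)))
  rw [Finset.sum_congr rfl fun m hm => if_pos (Finset.mem_range.1 hm)] at h
  refine (congrArg (fun f => HasSum f _) (funext fun m => ?_)).mpr h
  by_cases hm : m < b
  · rw [if_pos hm, sub_self, zeroUpTo, if_pos (by omega)]; simp
  · rw [if_neg hm, sub_zero, zeroUpTo, if_neg (by omega)]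

/-- Along the saddle points, `saddleScale` changes by a constant factor when the constant
coefficient of the polynomial does. -/
theorem saddleScale_sub_C (P : Polynomial ℝ) (q r : ℝ) :
    saddleScale (P - Polynomial.C q) r = Real.exp (-q) * saddleScale P r := by
  simp only [saddleScale, Polynomial.derivative_sub, Polynomial.derivative_C, sub_zero,
    Polynomial.eval_sub, Polynomial.eval_C]
  rw [← mul_div_assoc, ← Real.exp_add]
  congr 2; ring

/-- The coefficient asymptotics are applied twice along the same saddle points: to `g` with `P` and
no shift, and to `g - Q` with `P - q` and shift `j`. Both normalized limits are `1/√(2π)`, so only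
the ratio `e^{-q}` of the scales remains. Positivity of the first limit makes `h_n` eventually
positive. -/
theorem tendsto_normConst_ratio {θ : ℕ → ℝ≥0} {k : ℕ} (hθ : AdmissibleWeights θ k) :
    (∀ᶠ n : ℕ in atTop, 0 < normConst θ n) ∧ ∀ b j : ℕ,
      Tendsto (fun n => (normConst (zeroUpTo θ b) (n - j) : ℝ) / normConst θ n) atTop
        (𝓝 (Real.exp (-∑ m ∈ Finset.range b, (θ (m + 1) : ℝ) / ((m : ℝ) + 1)))) := by
  obtain ⟨hk, g, hsum, hdiff, hcont, c, hO⟩ := hθ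
  set P := logPoly k c with hP
  have hd : P.natDegree ≤ k + 1 := logPoly_natDegree_le k c
  have hlead : P.coeff (k + 1) = 1 / ((k : ℝ) + 1) := logPoly_coeff k c
  obtain ⟨r, hr, hrn⟩ := exists_saddle_seq hk hd hlead
  have hK : 0 < (√(2 * Real.pi))⁻¹ := by positivity
  have hscale : ∀ᶠ n in atTop, 0 < saddleScale P (r n) :=
    (hr.eventually ((tendsto_eval_derivative hk hd hlead).eventually_gt_atTop 0)).mono
      fun n hn => saddleScale_pos hn
  have h1 := tendsto_coeff_div_saddleScale hk hd hlead hdiff hcont hO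
    (a := fun n => normConst θ n) (coeff_exp_genFun hsum hdiff) hr hrn 0
  simp only [Nat.sub_zero] at h1
  have hpos : ∀ᶠ n : ℕ in atTop, 0 < normConst θ n := by
    filter_upwards [h1.eventually_const_lt hK, hscale] with n h2 h3
    exact_mod_cast (div_pos_iff_of_pos_right h3).1 h2
  refine ⟨hpos, fun b j => ?_⟩
  set Q : ℂ → ℂ := fun t => ∑ m ∈ Finset.range b,
    (((θ (m + 1) : ℝ) / ((m : ℝ) + 1) : ℝ) : ℂ) * t ^ (m + 1) with hQ
  set q : ℝ := ∑ m ∈ Finset.range b, (θ (m + 1) : ℝ) / ((m : ℝ) + 1) with hq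
  have hQ1 : Q 1 = (q : ℂ) := by simp [hQ, hq]
  have hQd : Differentiable ℂ Q := by fun_prop
  have hd' : (P - Polynomial.C q).natDegree ≤ k + 1 := by
    rw [Polynomial.natDegree_sub_C]; exact hd
  have hlead' : (P - Polynomial.C q).coeff (k + 1) = 1 / ((k : ℝ) + 1) := by
    rw [Polynomial.coeff_sub, Polynomial.coeff_C_succ, sub_zero, hlead]
  have hder' : Polynomial.derivative (P - Polynomial.C q) = Polynomial.derivative P := by simp
  -- `Q` is differentiable, so `Q(e^{-w}) = q + O(w)` and the expansion survives with constant term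
  -- lowered by `q`.
  have hO' : (fun w : ℂ => (g (Complex.exp (-w)) - Q (Complex.exp (-w)))
      - Polynomial.aeval (-Complex.log w) (P - Polynomial.C q))
        =O[𝓝[{w : ℂ | 0 ≤ w.re ∧ w ≠ 0}] 0] (fun w : ℂ => w) := by
    have h2 : (fun w : ℂ => Q (Complex.exp (-w)) - Q (Complex.exp (-0))) =O[𝓝 0]
        (fun w : ℂ => w - 0) := by
      have : DifferentiableAt ℂ (fun w : ℂ => Q (Complex.exp (-w))) 0 := by fun_prop
      exact this.isBigO_sub
    simp only [neg_zero, Complex.exp_zero, sub_zero, hQ1] at h2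
    refine (hO.sub (h2.mono nhdsWithin_le_nhds)).congr_left fun w => ?_
    simp
    ring
  have hsum' := fun t ht => hasSum_zeroUpTo b (hsum t ht)
  have hdiff' : DifferentiableOn ℂ (fun t => g t - Q t) (Metric.ball 0 1) :=
    hdiff.sub hQd.differentiableOn
  have h2 := tendsto_coeff_div_saddleScale hk hd' hlead' hdiff'
    (hcont.sub hQd.continuous.continuousOn) hO'
    (a := fun n => normConst (zeroUpTo θ b) n) (coeff_exp_genFun hsum' hdiff') hr
    (by simpa only [hder'] using hrn) j
  have h3 := (h2.div h1 hK.ne').mul_const (Real.exp (-q))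
  rw [div_self hK.ne', one_mul] at h3
  refine h3.congr' ?_
  filter_upwards [hpos, hscale] with n h4 h5
  have h4' : (normConst θ n : ℝ) ≠ 0 := by exact_mod_cast h4.ne'
  have h6 := Real.exp_ne_zero (-q)
  simp only [Pi.div_apply]
  rw [saddleScale_sub_C]
  field_simp

/-! ### Convergence in distribution -/

/-- On a countable space, convergence of the point masses implies convergence in law. -/
theorem tendsto_probabilityMeasure_of_singleton {E ι : Type*} [Countable E] [TopologicalSpace E]
    [MeasurableSpace E] [OpensMeasurableSpace E] [HasOuterApproxClosed E]
    [MeasurableSingletonClass E] {L : Filter ι} [L.IsCountablyGenerated]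
    {μ : ProbabilityMeasure E} {μs : ι → ProbabilityMeasure E}
    (h : ∀ a, Tendsto (fun i => (μs i : Measure E) {a}) L (𝓝 ((μ : Measure E) {a}))) :
    Tendsto μs L (𝓝 μ) := by
  rcases L.eq_or_neBot with rfl | hL
  · exact tendsto_bot
  -- Portmanteau criterion: the mass of `G` is the supremum of the masses of its finite subsets, and
  -- these masses converge.
  refine tendsto_of_forall_isOpen_le_liminf' fun G _ => ?_
  have hG : (μ : Measure E) G = ∑' a : G, (μ : Measure E) {(a : E)} := by
    rw [← measure_biUnion G.to_countable (fun a _ b _ hab => by simpa using hab)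
      (fun a _ => measurableSet_singleton a), Set.biUnion_of_singleton]
  rw [hG, ENNReal.tsum_eq_iSup_sum]
  refine iSup_le fun s => ?_
  have hs : Tendsto (fun i => ∑ a ∈ s, (μs i : Measure E) {(a : E)}) L
      (𝓝 (∑ a ∈ s, (μ : Measure E) {(a : E)})) := tendsto_finsetSum _ fun a _ => h a
  rw [← hs.liminf_eq]
  refine liminf_le_liminf (Eventually.of_forall fun i => ?_)
  refine (Finset.sum_map s (Function.Embedding.subtype (· ∈ G))
    fun a : E => (μs i : Measure E) {a}).symm.trans_le ?_
  rw [sum_measure_singleton]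
  refine measure_mono fun a ha => ?_
  obtain ⟨b, _, rfl⟩ := Finset.mem_map.1 ha
  exact b.2

theorem weightedMeasure_apply (θ : ℕ → ℝ≥0) (n : ℕ) (S : Set (Equiv.Perm (Fin n)))
    [DecidablePred (· ∈ S)] :
    weightedMeasure θ n S = ENNReal.ofReal
      ((∑ σ : Equiv.Perm (Fin n), (weight θ σ : ℝ) * (if σ ∈ S then 1 else 0)) / (n ! : ℝ)
        / normConst θ n) := by
  have h : ((∑ σ : Equiv.Perm (Fin n), (weight θ σ : ℝ) * (if σ ∈ S then 1 else 0)) / (n ! : ℝ)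
        / normConst θ n) = ((∑ σ : Equiv.Perm (Fin n),
          (weight θ σ / (normConst θ n * (n ! : ℝ≥0))) * (if σ ∈ S then 1 else 0) : ℝ≥0) : ℝ) := by
    push_cast
    rw [Finset.sum_div, Finset.sum_div]
    refine Finset.sum_congr rfl fun σ _ => ?_
    split_ifs <;> simp [div_div, mul_comm]
  rw [h, ENNReal.ofReal_coe_nnreal, weightedMeasure]
  push_cast
  rw [Measure.finsetSum_apply]
  refine Finset.sum_congr rfl fun σ _ => ?_
  rw [Measure.smul_apply, Measure.dirac_apply, smul_eq_mul, Set.indicator_apply]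
  split_ifs <;> simp

theorem tendsto_weightedMeasure_cycleCount {θ : ℕ → ℝ≥0} {k : ℕ} (hθ : AdmissibleWeights θ k)
    {b : ℕ} (a : Fin b → ℕ) :
    Tendsto (fun n : ℕ => weightedMeasure θ n {σ | (fun j : Fin b => cycleCount (j + 1) σ) = a})
      atTop (𝓝 (∏ j : Fin b, poissonMeasure (θ (j + 1) / ((j : ℝ≥0) + 1)) {a j})) := by
  have hlim : ∏ j : Fin b, poissonMeasure (θ (j + 1) / ((j : ℝ≥0) + 1)) {a j}
      = ENNReal.ofReal (multisetWeight θ (prescribed a)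
        * Real.exp (-∑ m ∈ Finset.range b, (θ (m + 1) : ℝ) / ((m : ℝ) + 1))) := by
    simp_rw [poissonMeasure_singleton]
    rw [← ENNReal.ofReal_prod_of_nonneg fun j _ => by positivity, multisetWeight_prescribed,
      Finset.sum_range, ← Finset.sum_neg_distrib, Real.exp_sum, ← Finset.prod_mul_distrib]
    congr 1
    refine Finset.prod_congr rfl fun j _ => ?_
    push_cast
    ring
  rw [hlim]
  refine (ENNReal.tendsto_ofReal (((tendsto_normConst_ratio hθ).2 b
    (prescribed a).sum).const_mul (multisetWeight θ (prescribed a)))).congr' ?_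
  filter_upwards [eventually_ge_atTop (prescribed a).sum] with n hn
  rw [weightedMeasure_apply, ← mul_div_assoc, ← sum_weight_cycleCount_eq θ a hn]
  rfl

end LogCycles

theorem theorem3p1 (θ : ℕ → ℝ≥0) (k : ℕ) (hθ : LogCycles.AdmissibleWeights θ k) :
    (∀ᶠ n : ℕ in atTop, 0 < LogCycles.normConst θ n) ∧
    ∀ (b : ℕ) {Ω : Type*} [MeasurableSpace Ω] (μ : Measure Ω) [IsProbabilityMeasure μ]
      (Y : Fin b → Ω → ℕ),
      iIndepFun Y μ →
      (∀ j : Fin b, HasLaw (Y j) (poissonMeasure (θ (j + 1) / ((j : ℝ≥0) + 1))) μ) →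
      TendstoInDistribution
        (fun (n : {n : ℕ // 0 < LogCycles.normConst θ n}) (σ : Equiv.Perm (Fin n)) (j : Fin b) =>
          LogCycles.cycleCount (j + 1) σ)
        atTop
        (fun ω j => Y j ω)
        (fun n => LogCycles.weightedMeasure θ n)
        μ := by
  have hpos := (LogCycles.tendsto_normConst_ratio hθ).1
  refine ⟨hpos, fun b Ω _ μ _ Y hY hlaw => ?_⟩
  -- Limits in `n` pass to the admissible indices, which include all large `n`.
  have hval : Tendsto (Subtype.val : {n : ℕ // 0 < LogCycles.normConst θ n} → ℕ) atTop atTop := by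
    obtain ⟨N, hN⟩ := eventually_atTop.1 hpos
    have : Nonempty {n : ℕ // 0 < LogCycles.normConst θ n} := ⟨⟨N, hN N le_rfl⟩⟩
    refine tendsto_atTop_atTop.2 fun m => ⟨⟨max N m, hN _ (le_max_left _ _)⟩, fun n hn => ?_⟩
    exact (le_max_right N m).trans hn
  have hYm : AEMeasurable (fun ω j => Y j ω) μ :=
    aemeasurable_pi_lambda _ fun j => (hlaw j).aemeasurable
  refine ⟨fun n => Measurable.of_discrete.aemeasurable, hYm,
    LogCycles.tendsto_probabilityMeasure_of_singleton fun a => ?_⟩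
  have hpi : μ.map (fun ω j => Y j ω) {a}
      = ∏ j : Fin b, poissonMeasure (θ (j + 1) / ((j : ℝ≥0) + 1)) {a j} := by
    rw [hY.map_fun_eq_pi_map fun j => (hlaw j).aemeasurable, Measure.pi_singleton]
    exact Finset.prod_congr rfl fun j _ => by rw [(hlaw j).map_eq]
  have h := (LogCycles.tendsto_weightedMeasure_cycleCount hθ a).comp hval
  rw [← hpi] at h
  refine h.congr fun n => ?_
  exact (Measure.map_apply Measurable.of_discrete (measurableSet_singleton a)).symm
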